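/- Let $M$ be a structure in a first-order language $\mathcal L$, let $G$ be a group $\emptyset$-definable in $M$ (with underlying set contained in some $M^n$), and let $\mathfrak C\succ M$ be a monster model: it is $\kappa$-saturated for a cardinal $\kappa>2^{\aleph_0+|\mathcal L|+|M|}$, and "bounded" means "of cardinality less than $\kappa$". Let $G^*$ be the interpretation of $G$ in $\mathfrak C$. Let $\Delta$ be a set of $\mathcal L$-formulas of the form $\psi(y\cdot x\cdot z;\bar t)$, where $x$ is the object variable, ranging over $G$, and $y,z,\bar t$ are parametric variables, $y$ and $z$ ranging over $G$. A $\Delta$-formula over $M$ is a Boolean combination of instances $\psi(a\cdot x\cdot b;\bar c)$ of formulas from $\Delta$ with parameters $a,b\in G$ and $\bar c$ from $M$. A subset of $G$ is $\Delta$-definable if it is defined in $G$ by a $\Delta$-formula over $M$; a subset of $G^*$ is $\Delta$-type-definable over $M$ if it is an intersection of subsets of $G^*$ defined by $\Delta$-formulas over $M$. Two elements of $G^*$ have the same $\Delta$-type over $M$ if they satisfy the same $\Delta$-formulas over $M$. A $\Delta$-definable compactification of $G$ is a homomorphism $f$ from $G$ to a compact Hausdorff group $K$ which has dense image and is $\Delta$-definable,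 i.e. for all disjoint closed $C_1,C_2\subseteq K$ the sets $f^{-1}[C_1]$ and $f^{-1}[C_2]$ can be separated by a $\Delta$-definable subset of $G$. It is universal if for every $\Delta$-definable compactification $f_1\colon G\to K_1$ there is a unique continuous homomorphism $h\colon K\to K_1$ with $h\circ f=f_1$. Proposition. There is a smallest subgroup ${G^*}^{00}_{\Delta,M}$ among the subgroups of $G^*$ which are $\Delta$-type-definable over $M$ and of bounded index. It contains $a^{-1}b$ for all $a,b\in G^*$ with the same $\Delta$-type over $M$, and it is normal in $G^*$. Equip $G^*/{G^*}^{00}_{\Delta,M}$ with the logic topology, in which a set is closed if and only if its preimage in $G^*$ is type-definable over $M$ (an intersection of sets definable over $M$ by arbitrary formulas). Then the natural homomorphism $\pi\colon G\to G^*/{G^*}^{00}_{\Delta,M}$ is a universal $\Delta$-definable compactification of $G$, and it is the unique one up to isomorphism: for every universal $\Delta$-definable compactification $f\colon G\to K$ there is a unique isomorphism of topological groups $e\colon G^*/{G^*}^{00}_{\Delta,M}\to K$ with $e\circ\pi=f$. That is, $\pi$ is the $\Delta$-definable Bohr compactification of $G$. -/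

import Mathlib

open FirstOrder FirstOrder.Language Cardinal

universe u v w w' x y

namespace DeltaBohr

section DefinableGroups

variable {L : FirstOrder.Language.{u, v}} {M : Type w} [L.Structure M]

/-- A group definable without parameters in the `L`-structure `M`: its underlying set
`{a ∈ M ^ n | M ⊨ dom(a)}` and the graph of its multiplication are given by `L`-formulas. -/
structure DefinableGroup (L : FirstOrder.Language.{u, v}) (M : Type w) [L.Structure M] (n : ℕ) where
  /-- the formula `G(x)` defining the underlying set -/
  dom : L.Formula (Fin n)
  /-- the formula defining the graph `x * y = z` of the multiplication -/
  mul : L.Formula (Fin n ⊕ Fin n ⊕ Fin n)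
  /-- the group structure -/
  [group : Group {a : Fin n → M // dom.Realize a}]
  mul_iff : ∀ a b c : {a : Fin n → M // dom.Realize a},
    mul.Realize (Sum.elim a.1 (Sum.elim b.1 c.1)) ↔ a * b = c

namespace DefinableGroup

variable {n : ℕ} (D : DefinableGroup L M n) {N : Type w'} [L.Structure N] (j : M ↪ₑ[L] N)

/-- The group `G` of points in `M`. -/
def G : Type w := {a : Fin n → M // D.dom.Realize a}

instance : Group D.G := D.group

/-- A tuple satisfying `dom` as an element of `G`. -/
def mkPt {a : Fin n → M} (ha : D.dom.Realize a) : D.G := ⟨a, ha⟩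

/-- The interpretation `G*` of `G` in an elementary extension `j : M → N`. -/
@[nolint unusedArguments]
def GStar (_j : M ↪ₑ[L] N) : Type w' := {a : Fin n → N // D.dom.Realize a}

/-- `dom` with its variables renamed. -/
def domAt {α : Type} (r : Fin n → α) : L.Formula α := D.dom.relabel r

/-- `mul` with its variables renamed. -/
def mulAt {α : Type} (r s t : Fin n → α) : L.Formula α :=
  D.mul.relabel (Sum.elim r (Sum.elim s t))

theorem realize_domAt {α : Type} (r : Fin n → α) (v : α → N) :
    (D.domAt r).Realize v ↔ D.dom.Realize (v ∘ r) := by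
  simp [domAt, Formula.realize_relabel]

theorem realize_mulAt {α : Type} (r s t : Fin n → α) (v : α → N) :
    (D.mulAt r s t).Realize v ↔
      D.mul.Realize (Sum.elim (v ∘ r) (Sum.elim (v ∘ s) (v ∘ t))) := by
  simp [mulAt, Formula.realize_relabel, Sum.comp_elim]

/-- Universal statements with parameters from `M` transfer to an elementary extension. -/
theorem transfer_forall {α γ : Type} [Finite γ] (φ : L.Formula (α ⊕ γ)) (v : α → M)
    (h : ∀ c : γ → M, φ.Realize (Sum.elim v c)) (c : γ → N) :
    φ.Realize (Sum.elim (j ∘ v) c) := by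
  have h1 : (φ.iAlls γ).Realize v := Formula.realize_iAlls.2 h
  exact Formula.realize_iAlls.1 ((j.map_formula _ v).2 h1) c

/-- `k` vectors of length `n` as one vector. -/
def pack {K : Type*} {k : ℕ} (f : Fin k → Fin n → K) : Fin k × Fin n → K := fun p => f p.1 p.2

theorem mul_iff' {a b c : Fin n → M} (ha : D.dom.Realize a) (hb : D.dom.Realize b)
    (hc : D.dom.Realize c) :
    D.mul.Realize (Sum.elim a (Sum.elim b c)) ↔ D.mkPt ha * D.mkPt hb = D.mkPt hc :=
  D.mul_iff ⟨a, ha⟩ ⟨b, hb⟩ ⟨c, hc⟩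

/-- Products exist in `G*`. -/
theorem star_mul_exists (a b : D.GStar j) :
    ∃ c : D.GStar j, D.mul.Realize (Sum.elim a.1 (Sum.elim b.1 c.1)) := by
  let p : Fin 2 → Fin n → (Empty ⊕ Fin 2 × Fin n) ⊕ Fin n := fun i q => .inl (.inr (i, q))
  let φ : L.Formula (Empty ⊕ Fin 2 × Fin n) :=
    (D.domAt (fun q => .inr ((0 : Fin 2), q))).imp
      ((D.domAt (fun q => .inr ((1 : Fin 2), q))).imp
        (Formula.iExs (Fin n) (D.domAt (fun q => .inr q) ⊓
          D.mulAt (p 0) (p 1) (fun q => .inr q))))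
  have h := transfer_forall j φ Empty.elim
    (fun c => by
      simp only [φ, Formula.realize_imp, Formula.realize_iExs, Formula.realize_inf,
        realize_domAt, realize_mulAt]
      exact fun h0 h1 => ⟨_, (D.mkPt h0 * D.mkPt h1).2, (D.mul_iff' h0 h1 (Subtype.prop _)).2 rfl⟩)
    (pack ![a.1, b.1])
  simp only [φ, Formula.realize_imp, Formula.realize_iExs, Formula.realize_inf,
    realize_domAt, realize_mulAt] at h
  obtain ⟨z, hz, hm⟩ := h a.2 b.2
  exact ⟨⟨z, hz⟩, hm⟩

/-- Products are unique in `G*`. -/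
theorem star_mul_unique (a b c d : D.GStar j)
    (h₁ : D.mul.Realize (Sum.elim a.1 (Sum.elim b.1 c.1)))
    (h₂ : D.mul.Realize (Sum.elim a.1 (Sum.elim b.1 d.1))) : c = d := by
  refine Subtype.ext (funext fun i => ?_)
  let p : Fin 4 → Fin n → Empty ⊕ Fin 4 × Fin n := fun i q => .inr (i, q)
  let φ : L.Formula (Empty ⊕ Fin 4 × Fin n) :=
    (D.domAt (p 0) ⊓ D.domAt (p 1) ⊓ D.domAt (p 2) ⊓ D.domAt (p 3) ⊓
      D.mulAt (p 0) (p 1) (p 2) ⊓ D.mulAt (p 0) (p 1) (p 3)).imp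
      (Term.equal (Term.var (p 2 i)) (Term.var (p 3 i)))
  have h := transfer_forall j φ Empty.elim (fun e => by
      simp only [φ, Formula.realize_imp, Formula.realize_inf, realize_domAt, realize_mulAt,
        Formula.realize_equal, Term.realize_var]
      rintro ⟨⟨⟨⟨⟨h0, h1⟩, h2⟩, h3⟩, h4⟩, h5⟩
      exact congrFun (congrArg Subtype.val
        (((D.mul_iff' h0 h1 h2).1 h4).symm.trans ((D.mul_iff' h0 h1 h3).1 h5))) i)
    (pack ![a.1, b.1, c.1, d.1])
  simp only [φ, Formula.realize_imp, Formula.realize_inf, realize_domAt, realize_mulAt,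
        Formula.realize_equal, Term.realize_var] at h
  exact h ⟨⟨⟨⟨⟨a.2, b.2⟩, c.2⟩, d.2⟩, h₁⟩, h₂⟩

/-- The multiplication of `G*`: the one whose graph is defined by the formula `mul`. -/
noncomputable instance : Mul (D.GStar j) := ⟨fun a b => (D.star_mul_exists j a b).choose⟩

/-- In `G*`, too, the formula `mul` defines the graph of multiplication. -/
theorem star_mul_iff (a b c : D.GStar j) :
    D.mul.Realize (Sum.elim a.1 (Sum.elim b.1 c.1)) ↔ a * b = c :=
  ⟨fun h => D.star_mul_unique j a b _ _ (D.star_mul_exists j a b).choose_spec h,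
    fun h => h ▸ (D.star_mul_exists j a b).choose_spec⟩

theorem star_mul_assoc (a b c : D.GStar j) : a * b * c = a * (b * c) := by
  refine Subtype.ext (funext fun i => ?_)
  let p : Fin 7 → Fin n → Empty ⊕ Fin 7 × Fin n := fun i q => .inr (i, q)
  let φ : L.Formula (Empty ⊕ Fin 7 × Fin n) :=
    (D.domAt (p 0) ⊓ D.domAt (p 1) ⊓ D.domAt (p 2) ⊓ D.domAt (p 3) ⊓ D.domAt (p 4) ⊓
      D.domAt (p 5) ⊓ D.domAt (p 6) ⊓ D.mulAt (p 0) (p 1) (p 3) ⊓ D.mulAt (p 3) (p 2) (p 4) ⊓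
      D.mulAt (p 1) (p 2) (p 5) ⊓ D.mulAt (p 0) (p 5) (p 6)).imp
      (Term.equal (Term.var (p 4 i)) (Term.var (p 6 i)))
  have h := transfer_forall j φ Empty.elim (fun e => by
      simp only [φ, Formula.realize_imp, Formula.realize_inf, realize_domAt, realize_mulAt,
        Formula.realize_equal, Term.realize_var]
      rintro ⟨⟨⟨⟨⟨⟨⟨⟨⟨⟨h0, h1⟩, h2⟩, h3⟩, h4⟩, h5⟩, h6⟩, h7⟩, h8⟩, h9⟩, h10⟩
      have e7 := (D.mul_iff' h0 h1 h3).1 h7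
      have e8 := (D.mul_iff' h3 h2 h4).1 h8
      have e9 := (D.mul_iff' h1 h2 h5).1 h9
      have e10 := (D.mul_iff' h0 h5 h6).1 h10
      rw [← e7, mul_assoc, e9, e10] at e8
      exact (congrFun (congrArg Subtype.val e8) i).symm)
    (pack ![a.1, b.1, c.1, (a * b).1, (a * b * c).1, (b * c).1, (a * (b * c)).1])
  simp only [φ, Formula.realize_imp, Formula.realize_inf, realize_domAt, realize_mulAt,
        Formula.realize_equal, Term.realize_var] at h
  exact h ⟨⟨⟨⟨⟨⟨⟨⟨⟨⟨a.2, b.2⟩, c.2⟩, (a * b).2⟩, (a * b * c).2⟩, (b * c).2⟩, (a * (b * c)).2⟩,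
    (D.star_mul_iff j _ _ _).2 rfl⟩, (D.star_mul_iff j _ _ _).2 rfl⟩,
    (D.star_mul_iff j _ _ _).2 rfl⟩, (D.star_mul_iff j _ _ _).2 rfl⟩

/-- The inclusion of `G` in `G*`. -/
def inclFun (a : D.G) : D.GStar j := ⟨j ∘ a.1, (j.map_formula D.dom a.1).2 a.2⟩

theorem inclFun_mul (a b : D.G) : D.inclFun j (a * b) = D.inclFun j a * D.inclFun j b := by
  refine ((D.star_mul_iff j _ _ _).1 ?_).symm
  have h := (j.map_formula D.mul _).2 ((D.mul_iff a b (a * b)).2 rfl)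
  simp only [Sum.comp_elim] at h
  exact h

theorem star_one_mul (a : D.GStar j) : D.inclFun j 1 * a = a := by
  let p : Fin n → Fin n ⊕ Fin n := fun q => .inr q
  let φ : L.Formula (Fin n ⊕ Fin n) :=
    (D.domAt p).imp (D.mulAt (fun q => .inl q) p p)
  have h := transfer_forall j φ (1 : D.G).1 (fun e => by
      simp only [φ, Formula.realize_imp, realize_domAt, realize_mulAt]
      exact fun h0 => (D.mul_iff' (1 : D.G).2 h0 h0).2 (one_mul _)) a.1
  simp only [φ, Formula.realize_imp, realize_domAt, realize_mulAt] at h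
  exact (D.star_mul_iff j _ _ _).1 (h a.2)

theorem star_inv_mul (a : D.GStar j) : ∃ b : D.GStar j, b * a = D.inclFun j 1 := by
  let p : Fin n → (Fin n ⊕ Fin n) ⊕ Fin n := fun q => .inl (.inr q)
  let φ : L.Formula (Fin n ⊕ Fin n) :=
    (D.domAt (fun q => .inr q)).imp (Formula.iExs (Fin n)
      (D.domAt (fun q => .inr q) ⊓ D.mulAt (fun q => .inr q) p (fun q => .inl (.inl q))))
  have h := transfer_forall j φ (1 : D.G).1 (fun e => by
      simp only [φ, Formula.realize_imp, Formula.realize_iExs, Formula.realize_inf,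
        realize_domAt, realize_mulAt]
      exact fun h0 => ⟨((D.mkPt h0)⁻¹).1, ((D.mkPt h0)⁻¹).2,
        (D.mul_iff' ((D.mkPt h0)⁻¹).2 h0 (1 : D.G).2).2 (inv_mul_cancel _)⟩) a.1
  simp only [φ, Formula.realize_imp, Formula.realize_iExs, Formula.realize_inf,
        realize_domAt, realize_mulAt] at h
  obtain ⟨b, hb, hm⟩ := h a.2
  exact ⟨⟨b, hb⟩, (D.star_mul_iff j _ _ _).1 hm⟩

/-- The group structure of `G*`. -/
noncomputable instance : Group (D.GStar j) :=
  letI : One (D.GStar j) := ⟨D.inclFun j 1⟩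
  letI : Inv (D.GStar j) := ⟨fun a => (D.star_inv_mul j a).choose⟩
  Group.ofLeftAxioms (D.star_mul_assoc j) (D.star_one_mul j)
    (fun a => (D.star_inv_mul j a).choose_spec)

/-- The inclusion of `G` in `G*` as a homomorphism. -/
noncomputable def incl : D.G →* D.GStar j := MonoidHom.mk' (D.inclFun j) (D.inclFun_mul j)

end DefinableGroup

end DefinableGroups

section Monster

variable (L : FirstOrder.Language.{u, v}) (C : Type w') [L.Structure C]

/-- `C` is `κ`-saturated: every finitely satisfiable family of sets of `n`-tuples definable over
a set `A` of fewer than `κ` parameters (that is, every partial `n`-type over `A`) is realized. -/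
def IsSaturated (κ : Cardinal.{w'}) : Prop :=
  ∀ A : Set C, #A < κ → ∀ (n : ℕ) (F : Set (Set (Fin n → C))),
    (∀ S ∈ F, A.Definable L S) →
    (∀ T : Set (Set (Fin n → C)), T ⊆ F → T.Finite → (⋂₀ T).Nonempty) →
    (⋂₀ F).Nonempty

/-- `C` is a `κ`-saturated model with `κ` large with respect to `M` and `L`, namely
`2 ^ (ℵ₀ + |L| + |M|) < κ`. This holds for every monster model containing `M`;
no homogeneity is demanded. -/
structure IsMonster (M : Type w) (κ : Cardinal.{w'}) : Prop where
  large : Cardinal.lift.{w'} ((2 : Cardinal.{max u v w}) ^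
    (ℵ₀ + Cardinal.lift.{w} L.card + Cardinal.lift.{max u v} #M)) <
      Cardinal.lift.{max u v w} κ
  saturated : IsSaturated L C κ

end Monster

namespace DefinableGroup

variable {L : FirstOrder.Language.{u, v}} {M : Type w} [L.Structure M] {n : ℕ} (D : DefinableGroup L M n)

/-- The family `Δ = {ψ(y · x · z; t) | ψ ∈ Ψ}` of formulas is given by the set `Ψ` of the formulas
`ψ(x; t)`, in which `x` is an `n`-tuple and `t` a tuple of some finite length `m`. -/
abbrev FormulaFamily (L : FirstOrder.Language.{u, v}) (n : ℕ) : Type (max u v) :=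
  Set (Σ m : ℕ, L.Formula (Fin n ⊕ Fin m))

/-- `S ⊆ G` is `Δ`-definable: it is defined in `G` by a Boolean combination of
instances `ψ(a · x · b; t)`, with `ψ ∈ Ψ` and parameters `a, b` from `G` and `t` from `M`. -/
def IsDeltaDefinable (Ψ : FormulaFamily L n) (S : Set D.G) : Prop :=
  S ∈ BooleanSubalgebra.closure {T : Set D.G | ∃ ψ ∈ Ψ, ∃ (a b : D.G) (t : Fin ψ.1 → M),
    T = {g | ψ.2.Realize (Sum.elim (a * g * b).1 t)}}

/-- A map from `G` to a (compact) space is `Δ`-definable: the preimages of disjoint closed sets can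
be separated by a `Δ`-definable set. -/
def IsDeltaDefinableMap (Ψ : FormulaFamily L n) {K : Type x} [TopologicalSpace K]
    (f : D.G → K) : Prop :=
  ∀ C₁ C₂ : Set K, IsClosed C₁ → IsClosed C₂ → Disjoint C₁ C₂ →
    ∃ S : Set D.G, D.IsDeltaDefinable Ψ S ∧ f ⁻¹' C₁ ⊆ S ∧ Disjoint S (f ⁻¹' C₂)

/-- A `Δ`-definable compactification of `G`: a `Δ`-definable homomorphism with dense image to a
compact Hausdorff group. -/
structure IsDeltaCompactification (Ψ : FormulaFamily L n) {K : Type x} [Group K]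
    [TopologicalSpace K] (f : D.G →* K) : Prop where
  isTopologicalGroup : IsTopologicalGroup K
  compactSpace : CompactSpace K
  t2Space : T2Space K
  isDeltaDefinableMap : D.IsDeltaDefinableMap Ψ f
  denseRange : DenseRange f

/-- A universal `Δ`-definable compactification `f` of `G`: for every `Δ`-definable compactification
`f₁` of `G` (on a group in the universe `y`), there is a unique morphism from `f` to `f₁`, that is,
a unique continuous homomorphism `h` with `h ∘ f = f₁`. -/
def IsUniversalDeltaCompactification (Ψ : FormulaFamily L n) {K : Type x} [Group K]
    [TopologicalSpace K] (f : D.G →* K) : Prop :=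
  D.IsDeltaCompactification Ψ f ∧
    ∀ (K₁ : Type y) [Group K₁] [TopologicalSpace K₁] (f₁ : D.G →* K₁),
      D.IsDeltaCompactification Ψ f₁ → ∃! h : K →ₜ* K₁, ∀ g, h (f g) = f₁ g

variable {C : Type w'} [L.Structure C] (j : M ↪ₑ[L] C)

/-- `S ⊆ G*` is defined by a `Δ`-formula over `M`, i.e. by a Boolean combination of
instances `ψ(a · x · b; t)`, with `ψ ∈ Ψ` and parameters `a, b` from `G` and `t` from `M`. -/
def IsDeltaDefinableStar (Ψ : FormulaFamily L n) (S : Set (D.GStar j)) : Prop :=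
  S ∈ BooleanSubalgebra.closure {T : Set (D.GStar j) | ∃ ψ ∈ Ψ, ∃ (a b : D.G) (t : Fin ψ.1 → M),
    T = {g | ψ.2.Realize (Sum.elim (D.incl j a * g * D.incl j b).1 (j ∘ t))}}

/-- `S ⊆ G*` is `Δ`-type-definable over `M`. -/
def IsDeltaTypeDefinable (Ψ : FormulaFamily L n) (S : Set (D.GStar j)) : Prop :=
  ∃ F : Set (Set (D.GStar j)), (∀ T ∈ F, D.IsDeltaDefinableStar j Ψ T) ∧ S = ⋂₀ F

/-- `a` and `b` in `G*` have the same complete `Δ`-type over `M`. -/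
def SameDeltaType (Ψ : FormulaFamily L n) (a b : D.GStar j) : Prop :=
  ∀ S : Set (D.GStar j), D.IsDeltaDefinableStar j Ψ S → (a ∈ S ↔ b ∈ S)

/-- `S ⊆ G*` is definable (by an arbitrary formula) over `M`. -/
def IsDefinableStar (S : Set (D.GStar j)) : Prop :=
  ∃ T : Set (Fin n → C), (Set.range j).Definable L T ∧ S = {g | g.1 ∈ T}

/-- `S ⊆ G*` is type-definable over `M`. -/
def IsTypeDefinable (S : Set (D.GStar j)) : Prop :=
  ∃ F : Set (Set (D.GStar j)), (∀ T ∈ F, D.IsDefinableStar j T) ∧ S = ⋂₀ F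

/-- The `Δ`-type-definable over `M` subgroups of `G*` of bounded index, i.e. of index less than the
degree of saturation `κ` of the monster model. -/
def boundedSubgroups (Ψ : FormulaFamily L n) (κ : Cardinal.{w'}) : Set (Subgroup (D.GStar j)) :=
  {H | D.IsDeltaTypeDefinable j Ψ (H : Set (D.GStar j)) ∧ #(D.GStar j ⧸ H) < κ}

/-- The connected component of `G*` with respect to `Δ` and `M`. -/
noncomputable def component (Ψ : FormulaFamily L n) (κ : Cardinal.{w'}) : Subgroup (D.GStar j) :=
  sInf (D.boundedSubgroups j Ψ κ)

theorem isDefinableStar_empty : D.IsDefinableStar j ∅ :=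
  ⟨∅, Set.definable_empty, rfl⟩

theorem IsDefinableStar.union {S T : Set (D.GStar j)} (hS : D.IsDefinableStar j S)
    (hT : D.IsDefinableStar j T) : D.IsDefinableStar j (S ∪ T) := by
  obtain ⟨S', hS', rfl⟩ := hS
  obtain ⟨T', hT', rfl⟩ := hT
  exact ⟨S' ∪ T', hS'.union hT', rfl⟩

/-- The logic topology on `G* ⧸ H`: a set is closed when its preimage in `G*` is type-definable
over `M`. -/
noncomputable instance logicTopology (H : Subgroup (D.GStar j)) : TopologicalSpace (D.GStar j ⧸ H) :=
  TopologicalSpace.ofClosed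
    {S | D.IsTypeDefinable j ((fun g : D.GStar j => (g : D.GStar j ⧸ H)) ⁻¹' S)}
    ⟨{∅}, by simpa using D.isDefinableStar_empty j, by simp⟩
    (by
      intro A hA
      refine ⟨{T | D.IsDefinableStar j T ∧
        (fun g : D.GStar j => (g : D.GStar j ⧸ H)) ⁻¹' ⋂₀ A ⊆ T}, fun T hT => hT.1, ?_⟩
      refine Set.Subset.antisymm (fun g hg T hT => hT.2 hg) (fun g hg S hS => ?_)
      obtain ⟨F, hF, hF'⟩ := hA hS
      have h1 : g ∈ ((fun g : D.GStar j => (g : D.GStar j ⧸ H)) ⁻¹' S) := by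
        rw [hF']
        refine fun T hT => hg T ⟨hF T hT, fun x hx => ?_⟩
        have h2 : x ∈ ((fun g : D.GStar j => (g : D.GStar j ⧸ H)) ⁻¹' S) := hx S hS
        rw [hF'] at h2
        exact h2 T hT
      exact h1)
    (by
      rintro A ⟨F, hF, hA⟩ B ⟨F', hF', hB⟩
      refine ⟨{U | ∃ S ∈ F, ∃ T ∈ F', U = S ∪ T}, ?_, ?_⟩
      · rintro U ⟨S, hS, T, hT, rfl⟩
        exact (hF S hS).union D j (hF' T hT)
      · rw [Set.preimage_union, hA, hB, Set.sInter_union_sInter]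
        ext g
        simp only [Set.mem_iInter, Set.mem_sInter, Set.mem_ofPred_eq, Set.mem_prod, Prod.forall]
        constructor
        · rintro h U ⟨S, hS, T, hT, rfl⟩
          exact h S T ⟨hS, hT⟩
        · rintro h S T ⟨hS, hT⟩
          exact h _ ⟨S, hS, T, hT, rfl⟩)

/-- The natural homomorphism from `G` to `G* ⧸ H`, for a normal subgroup `H`. -/
noncomputable def natural (H : Subgroup (D.GStar j)) [H.Normal] : D.G →* D.GStar j ⧸ H :=
  (QuotientGroup.mk' H).comp (D.incl j)

end DefinableGroup

end DeltaBohr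

/-! Everything rests on two facts about a Δ-type-definable subgroup `H` of bounded index and a
Δ-definable `T ⊇ H`. By saturation some Δ-definable `S ⊇ H` satisfies `S⁻¹SS ⊆ T`
(`exists_deltaNhds_inv_mul_mul`), and finitely many translates of `T` by elements of `G`, not just
of `G*`, cover `G*` (`exists_finite_cover`).

If `a` and `b` have the same Δ-type, they lie in a common translate `cS` with `c ∈ G`, so `a⁻¹b ∈
S⁻¹S ⊆ T`; hence `a⁻¹b ∈ H`. The intersection of all such `H` inherits this property, and its index
is bounded because there are few Δ-types. It is stable under conjugation by `G`, and writing `g =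
p⁻¹a` with `p ∈ S`, `a ∈ G` extends this to `G*`.

The images of the sets `T` form a neighbourhood basis of `1` for a Hausdorff group topology on the
quotient. The logic topology is compact and finer, so the two agree (`logicTopology_eq`).
Conversely, a Δ-definable compactification extends by density to a homomorphism on `G*`
(`exists_extension`). Its kernel is Δ-type-definable of bounded index, so it contains the component,
and the extension factors through the quotient. -/

namespace DeltaBohr

namespace DefinableGroup

variable {L : FirstOrder.Language.{u, v}} {M : Type w} [L.Structure M] {n : ℕ}
  (D : DefinableGroup L M n) {C : Type w'} [L.Structure C] (j : M ↪ₑ[L] C)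

/-! ### Definable relations on `G*`, elementarity and saturation -/

/-- The coordinates of a tuple of elements of `G*`. -/
def coords {I : Type} (x : I → D.GStar j) : I × Fin n → C := fun p => (x p.1).1 p.2

theorem coords_injective {I : Type} :
    Function.Injective (D.coords j : (I → D.GStar j) → I × Fin n → C) := fun _ _ h =>
  funext fun i => Subtype.ext (funext fun q => congrFun h (i, q))

/-- `R` is a relation on `G*` definable with parameters from `A`. -/
def DefRel (A : Set C) {I : Type} (R : Set (I → D.GStar j)) : Prop :=
  ∃ T : Set (I × Fin n → C), A.Definable L T ∧ R = D.coords j ⁻¹' T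

/-- The tuples all of whose entries lie in `G*`. -/
def domSet (I : Type) : Set (I × Fin n → C) := {v | ∀ i, D.dom.Realize fun q => v (i, q)}

variable {D j} {A : Set C} {I J : Type}

theorem definable_of_formula {α : Type} (φ : L.Formula α) :
    A.Definable L {v : α → C | φ.Realize v} :=
  (Set.empty_definable_iff.2 ⟨φ, rfl⟩).mono (Set.empty_subset A)

theorem definable_domSet [Finite I] : A.Definable L (D.domSet (C := C) I) := by
  have h : D.domSet (C := C) I = ⋂ i, {v : I × Fin n → C |
      (D.domAt (fun q => (i, q))).Realize v} := by
    ext v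
    simp [domSet, realize_domAt, Function.comp_def]
  rw [h]
  exact Set.definable_iInter_of_finite fun i => definable_of_formula _

theorem range_coords : Set.range (D.coords j (I := I)) = D.domSet I := by
  ext v
  refine ⟨?_, fun h => ⟨fun i => ⟨fun q => v (i, q), h i⟩, rfl⟩⟩
  rintro ⟨x, rfl⟩ i
  exact (x i).2

theorem DefRel.image_coords [Finite I] {R : Set (I → D.GStar j)} (h : D.DefRel j A R) :
    A.Definable L (D.coords j '' R) := by
  obtain ⟨T, hT, rfl⟩ := h
  rw [Set.image_preimage_eq_inter_range, range_coords]
  exact hT.inter definable_domSet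

namespace DefRel

theorem mono {B : Set C} {R : Set (I → D.GStar j)} (h : D.DefRel j A R) (hAB : A ⊆ B) :
    D.DefRel j B R :=
  let ⟨T, hT, e⟩ := h
  ⟨T, hT.mono hAB, e⟩

theorem compl {R : Set (I → D.GStar j)} (h : D.DefRel j A R) : D.DefRel j A Rᶜ := by
  obtain ⟨T, hT, rfl⟩ := h
  exact ⟨Tᶜ, hT.compl, rfl⟩

theorem inter {R S : Set (I → D.GStar j)} (hR : D.DefRel j A R) (hS : D.DefRel j A S) :
    D.DefRel j A (R ∩ S) := by
  obtain ⟨T, hT, rfl⟩ := hR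
  obtain ⟨T', hT', rfl⟩ := hS
  exact ⟨T ∩ T', hT.inter hT', rfl⟩

theorem union {R S : Set (I → D.GStar j)} (hR : D.DefRel j A R) (hS : D.DefRel j A S) :
    D.DefRel j A (R ∪ S) := by
  obtain ⟨T, hT, rfl⟩ := hR
  obtain ⟨T', hT', rfl⟩ := hS
  exact ⟨T ∪ T', hT.union hT', rfl⟩

theorem empty : D.DefRel j A (∅ : Set (I → D.GStar j)) := ⟨∅, Set.definable_empty, rfl⟩

theorem univ : D.DefRel j A (Set.univ : Set (I → D.GStar j)) := ⟨_, Set.definable_univ, rfl⟩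

theorem iInter {ι : Type} [Finite ι] {R : ι → Set (I → D.GStar j)}
    (h : ∀ i, D.DefRel j A (R i)) : D.DefRel j A (⋂ i, R i) := by
  choose T hT e using h
  refine ⟨⋂ i, T i, Set.definable_iInter_of_finite hT, ?_⟩
  simp only [e, Set.preimage_iInter]

theorem preimage {R : Set (J → D.GStar j)} (h : D.DefRel j A R) (f : J → I) :
    D.DefRel j A {x : I → D.GStar j | x ∘ f ∈ R} := by
  obtain ⟨T, hT, rfl⟩ := h
  exact ⟨_, hT.preimage_comp (Prod.map f id), rfl⟩

/-- For injective `f` this is existential quantification over `G*`. The quantifier stays inside `G*`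
because `image_coords` first intersects with the definable set of tuples lying in `G*`. -/
theorem image [Finite I] [Finite J] {R : Set (J → D.GStar j)} (h : D.DefRel j A R) (f : I → J) :
    D.DefRel j A {x : I → D.GStar j | ∃ y ∈ R, y ∘ f = x} := by
  refine ⟨_, h.image_coords.image_comp (Prod.map f id), ?_⟩
  ext x
  constructor
  · rintro ⟨y, hy, rfl⟩
    exact ⟨_, ⟨y, hy, rfl⟩, rfl⟩
  · rintro ⟨_, ⟨y, hy, rfl⟩, e⟩
    exact ⟨y, hy, D.coords_injective j e⟩

theorem mul (a b c : I) : D.DefRel j A {x : I → D.GStar j | x a * x b = x c} := by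
  refine ⟨_, definable_of_formula
    (D.mulAt (fun q => (a, q)) (fun q => (b, q)) (fun q => (c, q))), ?_⟩
  ext x
  simp only [Set.mem_preimage, Set.mem_ofPred_eq, realize_mulAt, ← D.star_mul_iff]
  rfl

theorem const (i : I) {a : D.GStar j} (ha : Set.range a.1 ⊆ A) :
    D.DefRel j A {x : I → D.GStar j | x i = a} := by
  refine ⟨{v | ∀ q, v (i, q) = a.1 q}, ?_, ?_⟩
  · rw [Set.ofPred_forall]
    refine Set.definable_iInter_of_finite fun q => ?_
    refine Set.definable_iff_exists_formula_sum.2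
      ⟨Term.equal (Term.var (Sum.inr (i, q))) (Term.var (Sum.inl ⟨a.1 q, ha ⟨q, rfl⟩⟩)), ?_⟩
    ext v
    simp [Formula.realize_equal]
  · ext x
    simp only [Set.mem_ofPred_eq, Set.mem_preimage]
    exact ⟨fun h q => by rw [← h]; rfl, fun h => Subtype.ext (funext h)⟩

end DefRel

/-- `S ⊆ G*` is definable with parameters from `A`. -/
def DefOver (A : Set C) (S : Set (D.GStar j)) : Prop :=
  D.DefRel j A {x : Unit → D.GStar j | x () ∈ S}

theorem DefOver.mono {B : Set C} {S : Set (D.GStar j)} (h : DefOver A S) (hAB : A ⊆ B) :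
    DefOver B S := DefRel.mono h hAB

theorem DefOver.mem {S : Set (D.GStar j)} (h : DefOver A S) (i : I) :
    D.DefRel j A {x : I → D.GStar j | x i ∈ S} :=
  DefRel.preimage h fun _ => i

theorem DefOver.of_formula (φ : L.Formula (A ⊕ Fin n)) :
    DefOver (D := D) (j := j) A {g | φ.Realize (Sum.elim (↑) g.1)} :=
  ⟨_, Set.Definable.preimage_comp (fun q : Fin n => ((), q))
    (Set.definable_iff_exists_formula_sum.2 ⟨φ, rfl⟩), rfl⟩

theorem defOver_iff {S : Set (D.GStar j)} :
    DefOver (Set.range j) S ↔ D.IsDefinableStar j S := by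
  constructor
  · rintro ⟨T, hT, e⟩
    refine ⟨_, hT.preimage_comp (fun p : Unit × Fin n => p.2), ?_⟩
    ext g
    exact Set.ext_iff.1 e fun _ => g
  · rintro ⟨T, hT, rfl⟩
    exact ⟨_, hT.preimage_comp (fun q : Fin n => ((), q)), rfl⟩

theorem DefOver.translate {S : Set (D.GStar j)} (h : DefOver A S) {a b : D.GStar j}
    (ha : Set.range a.1 ⊆ A) (hb : Set.range b.1 ⊆ A) : DefOver A {g | a * g * b ∈ S} := by
  -- The five coordinates stand for `g`, `a`, `b`, `a * g`, `a * g * b`.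
  have h1 : D.DefRel j A {x : Fin 5 → D.GStar j |
      x 1 = a ∧ x 2 = b ∧ x 1 * x 0 = x 3 ∧ x 3 * x 2 = x 4 ∧ x 4 ∈ S} :=
    (DefRel.const 1 ha).inter ((DefRel.const 2 hb).inter ((DefRel.mul 1 0 3).inter
      ((DefRel.mul 3 2 4).inter (h.mem 4))))
  unfold DefOver
  convert! h1.image (fun _ : Unit => 0) using 1
  ext x
  constructor
  · intro hx
    exact ⟨![x (), a, b, a * x (), a * x () * b], ⟨rfl, rfl, rfl, rfl, hx⟩, rfl⟩
  · rintro ⟨y, ⟨rfl, rfl, h3, h4, h5⟩, rfl⟩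
    simp only [Function.comp, Set.mem_ofPred_eq]
    rwa [h3, h4]

/-- A nonempty relation on `G*` definable over `M` contains a tuple of elements of `G`. -/
theorem DefRel.exists_incl_mem [Finite I] {R : Set (I → D.GStar j)}
    (h : D.DefRel j (Set.range j) R) (hR : R.Nonempty) :
    ∃ y : I → D.G, (fun i => D.incl j (y i)) ∈ R := by
  obtain ⟨φ, hφ⟩ := Set.definable_iff_exists_formula_sum.1 h.image_coords
  -- Pulling the parameters back to `M` turns nonemptiness of `R` into an existential formula over
  -- `M`, which elementarity transfers down.
  let r : Set.range j → M := fun c => c.2.choose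
  have hr : ∀ c, j (r c) = c := fun c => c.2.choose_spec
  let ψ : L.Formula (M ⊕ (I × Fin n)) := φ.relabel (Sum.map r id)
  have hψ (v : I × Fin n → C) : ψ.Realize (Sum.elim j v) ↔ v ∈ D.coords j '' R := by
    rw [hφ, Formula.realize_relabel, Set.mem_ofPred_eq]
    refine iff_of_eq (congrArg _ (funext fun c => ?_))
    cases c
    · exact hr _
    · rfl
  obtain ⟨x, hx⟩ := hR
  have h1 : (ψ.iExs (I × Fin n)).Realize (j ∘ id) :=
    Formula.realize_iExs.2 ⟨_, (hψ _).2 ⟨x, hx, rfl⟩⟩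
  obtain ⟨v, hv⟩ := Formula.realize_iExs.1 ((j.map_formula _ id).1 h1)
  have h2 := (j.map_formula _ _).2 hv
  rw [Sum.comp_elim] at h2
  obtain ⟨z, hz, e⟩ := (hψ _).1 h2
  refine ⟨fun i => ⟨fun q => v (i, q), ?_⟩, ?_⟩
  · refine (j.map_formula D.dom _).1 ?_
    have h3 : (z i).1 = j ∘ fun q => v (i, q) := funext fun q => congrFun e (i, q)
    exact h3 ▸ (z i).2
  · convert hz using 1
    exact D.coords_injective j e.symm

/-- Saturation for relations on `G*`. -/
theorem DefRel.saturation [Finite I] {κ : Cardinal.{w'}} (hC : IsSaturated L C κ) (hA : #A < κ)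
    (F : Set (Set (I → D.GStar j))) (hF : ∀ R ∈ F, D.DefRel j A R)
    (hfin : ∀ E ⊆ F, E.Finite → (⋂₀ E).Nonempty) : (⋂₀ F).Nonempty := by
  obtain ⟨m, ⟨e⟩⟩ := Finite.exists_equiv_fin (I × Fin n)
  let enc (x : I → D.GStar j) : Fin m → C := D.coords j x ∘ e.symm
  have henc : Function.Injective enc := fun x y h =>
    D.coords_injective j (e.symm.surjective.injective_comp_right h)
  -- Adding `Set.univ` forces the realized tuple to encode elements of `G*`, even when `F` is empty.
  have hdef : ∀ R ∈ insert Set.univ F, A.Definable L (enc '' R) := by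
    intro R hR
    have h1 : D.DefRel j A R := hR.elim (fun h => h ▸ DefRel.univ) (hF R)
    have h2 := h1.image_coords.image_comp e.symm
    rwa [Set.image_image] at h2
  obtain ⟨v, hv⟩ := hC A hA m (Set.image enc '' insert Set.univ F)
    (by rintro _ ⟨R, hR, rfl⟩; exact hdef R hR)
    (by
      intro T hT hTf
      obtain ⟨E, hE, hEf, rfl⟩ := Set.exists_subset_image_finite_and.1 ⟨T, hT, hTf, rfl⟩
      obtain ⟨x, hx⟩ := hfin (E \ {Set.univ})
        (fun R hR => (hE hR.1).resolve_left hR.2) hEf.sdiff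
      refine ⟨enc x, ?_⟩
      rintro _ ⟨R, hR, rfl⟩
      refine ⟨x, ?_, rfl⟩
      by_cases h : R = Set.univ
      · exact h ▸ trivial
      · exact hx R ⟨hR, h⟩)
  obtain ⟨x, -, rfl⟩ := hv _ ⟨Set.univ, Set.mem_insert _ _, rfl⟩
  refine ⟨x, fun R hR => ?_⟩
  obtain ⟨y, hy, e⟩ := hv _ ⟨R, Set.mem_insert_of_mem _ hR, rfl⟩
  exact henc e ▸ hy

end DefinableGroup

end DeltaBohr

/-! ### Calculus of Δ-definable and Δ-type-definable sets -/

namespace DeltaBohr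

namespace DefinableGroup

variable {L : FirstOrder.Language.{u, v}} {M : Type w} [L.Structure M] {n : ℕ}
  {D : DefinableGroup L M n} {C : Type w'} [L.Structure C] {j : M ↪ₑ[L] C}

theorem DefRel.saturation_directed {A : Set C} {I : Type} [Finite I] {κ : Cardinal.{w'}}
    (hC : IsSaturated L C κ) (hA : #A < κ) {ι : Type*} [Nonempty ι] (R : ι → Set (I → D.GStar j))
    (hR : ∀ i, D.DefRel j A (R i)) (hdir : Directed (· ⊇ ·) R) (hne : ∀ i, (R i).Nonempty) :
    (⋂ i, R i).Nonempty := by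
  have h := DefRel.saturation hC hA (Set.range R) (by rintro _ ⟨i, rfl⟩; exact hR i) (by
    intro E hE hEf
    rw [← Set.image_univ] at hE
    obtain ⟨s, -, hs, rfl⟩ := Set.exists_subset_image_finite_and.1 ⟨E, hE, hEf, rfl⟩
    obtain ⟨z, hz⟩ := hdir.finite_set_le hs
    obtain ⟨x, hx⟩ := hne z
    refine ⟨x, ?_⟩
    rintro _ ⟨i, hi, rfl⟩
    exact hz i hi hx)
  rwa [Set.sInter_range] at h

theorem range_incl_subset (a : D.G) : Set.range (D.incl j a).1 ⊆ Set.range j := by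
  rintro _ ⟨q, rfl⟩
  exact ⟨a.1 q, rfl⟩

namespace IsDeltaDefinableStar

variable {Ψ : FormulaFamily L n} {S T : Set (D.GStar j)}

theorem compl (hS : D.IsDeltaDefinableStar j Ψ S) : D.IsDeltaDefinableStar j Ψ Sᶜ :=
  BooleanSubalgebra.compl_mem hS

theorem inter (hS : D.IsDeltaDefinableStar j Ψ S) (hT : D.IsDeltaDefinableStar j Ψ T) :
    D.IsDeltaDefinableStar j Ψ (S ∩ T) :=
  BooleanSubalgebra.infClosed _ hS hT

theorem union (hS : D.IsDeltaDefinableStar j Ψ S) (hT : D.IsDeltaDefinableStar j Ψ T) :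
    D.IsDeltaDefinableStar j Ψ (S ∪ T) :=
  BooleanSubalgebra.supClosed _ hS hT

theorem empty : D.IsDeltaDefinableStar j Ψ ∅ := BooleanSubalgebra.bot_mem

theorem univ : D.IsDeltaDefinableStar j Ψ Set.univ := BooleanSubalgebra.top_mem

/-- The shape `ψ(y · x · z; t)` absorbs two-sided translation into the parameters. This works only
for `a`, `b` in `G`, which is why covers by `G`-translates are needed later. -/
theorem translate (hS : D.IsDeltaDefinableStar j Ψ S) (a b : D.G) :
    D.IsDeltaDefinableStar j Ψ {g | D.incl j a * g * D.incl j b ∈ S} := by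
  induction hS using BooleanSubalgebra.closure_bot_sup_induction with
  | mem T hT =>
    obtain ⟨ψ, hψ, c, d, t, rfl⟩ := hT
    refine BooleanSubalgebra.subset_closure ⟨ψ, hψ, c * a, b * d, t, ?_⟩
    ext g
    simp only [Set.mem_ofPred_eq, map_mul, mul_assoc]
  | bot => exact empty
  | sup _ _ _ _ hx hy => exact hx.union hy
  | compl _ _ hx => exact hx.compl

theorem defOver (hS : D.IsDeltaDefinableStar j Ψ S) : DefOver (Set.range j) S := by
  induction hS using BooleanSubalgebra.closure_bot_sup_induction with
  | mem T hT =>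
    obtain ⟨ψ, hψ, c, d, t, rfl⟩ := hT
    have h := DefOver.of_formula (D := D) (j := j) (A := Set.range j)
      (ψ.2.relabel (Sum.elim Sum.inr fun q => Sum.inl ⟨j (t q), t q, rfl⟩))
    convert! h.translate (range_incl_subset c) (range_incl_subset d) using 1
    ext g
    simp only [Set.mem_ofPred_eq, Formula.realize_relabel]
    refine iff_of_eq (congrArg _ (funext fun q => ?_))
    cases q <;> rfl
  | bot => exact DefRel.empty
  | sup _ _ _ _ hx hy => exact DefRel.union hx hy
  | compl _ _ hx => exact DefRel.compl hx

end IsDeltaDefinableStar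

theorem isDeltaTypeDefinable_iff {Ψ : FormulaFamily L n} {S : Set (D.GStar j)} :
    D.IsDeltaTypeDefinable j Ψ S ↔
      ∀ g ∉ S, ∃ T, D.IsDeltaDefinableStar j Ψ T ∧ S ⊆ T ∧ g ∉ T := by
  constructor
  · rintro ⟨F, hF, rfl⟩ g hg
    simp only [Set.mem_sInter, not_forall] at hg
    obtain ⟨T, hT, hgT⟩ := hg
    exact ⟨T, hF T hT, Set.sInter_subset_of_mem hT, hgT⟩
  · intro h
    refine ⟨{T | D.IsDeltaDefinableStar j Ψ T ∧ S ⊆ T}, fun T hT => hT.1,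
      Set.Subset.antisymm (fun g hg T hT => hT.2 hg) fun g hg => ?_⟩
    by_contra hgS
    obtain ⟨T, hT, hST, hgT⟩ := h g hgS
    exact hgT (hg T ⟨hT, hST⟩)

theorem IsDeltaTypeDefinable.isTypeDefinable {Ψ : FormulaFamily L n} {S : Set (D.GStar j)}
    (h : D.IsDeltaTypeDefinable j Ψ S) : D.IsTypeDefinable j S :=
  let ⟨F, hF, e⟩ := h
  ⟨F, fun T hT => defOver_iff.1 (hF T hT).defOver, e⟩

/-- The `Δ`-definable sets containing the subgroup `H`. -/
def deltaNhds (Ψ : FormulaFamily L n) (H : Subgroup (D.GStar j)) : Set (Set (D.GStar j)) :=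
  {T | D.IsDeltaDefinableStar j Ψ T ∧ (H : Set (D.GStar j)) ⊆ T}

/-! ### Counting Δ-types -/

section Cardinals

omit [L.Structure M] in
theorem _root_.DeltaBohr.IsMonster.aleph0_lt {κ : Cardinal.{w'}} (hC : IsMonster L C M κ) : ℵ₀ < κ := by
  have h : (ℵ₀ : Cardinal.{max u v w}) < 2 ^
      (ℵ₀ + Cardinal.lift.{w} L.card + Cardinal.lift.{max u v} #M) :=
    (cantor _).trans_le' (by rw [add_assoc]; exact self_le_add_right _ _)
  have h2 := (Cardinal.lift_lt.{_, w'}.2 h).trans hC.large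
  rwa [lift_aleph0, aleph0_lt_lift] at h2

theorem _root_.DeltaBohr.IsMonster.mk_range_lt {κ : Cardinal.{w'}} (hC : IsMonster L C M κ) :
    #(Set.range j) < κ := by
  have h : Cardinal.lift.{max u v} #M < (2 : Cardinal.{max u v w}) ^
      (ℵ₀ + Cardinal.lift.{w} L.card + Cardinal.lift.{max u v} #M) :=
    (cantor _).trans_le' (self_le_add_left _ _)
  have h2 := (Cardinal.lift_lt.{_, w'}.2 h).trans hC.large
  have h3 : Cardinal.lift.{max u v w} #(Set.range j) = Cardinal.lift.{max u v w'} #M :=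
    Cardinal.lift_mk_eq.{w', w, max u v}.2 ⟨(Equiv.ofInjective j j.injective).symm⟩
  rw [← Cardinal.lift_lt.{w', max u v w}, h3]
  simpa using h2

/-- The indices for the instances `ψ(a · x · b; t)` over `M`. -/
abbrev InstanceIndex (D : DefinableGroup L M n) (Ψ : FormulaFamily L n) :=
  Σ ψ : Ψ, D.G × D.G × (Fin ψ.1.1 → M)

/-- An instance is coded by a formula and three finite lists of elements of `M`. -/
theorem mk_instanceIndex_le (Ψ : FormulaFamily L n) :
    #(InstanceIndex D Ψ) ≤ ℵ₀ + Cardinal.lift.{w} L.card + Cardinal.lift.{max u v} #M := by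
  set c : Cardinal.{max u v w} :=
    ℵ₀ + Cardinal.lift.{w} L.card + Cardinal.lift.{max u v} #M with hc
  have h0 : ℵ₀ ≤ c := by rw [hc, add_assoc]; exact self_le_add_right _ _
  have hLc : Cardinal.lift.{w} L.card ≤ c := (self_le_add_left _ _).trans (self_le_add_right _ _)
  have hM : Cardinal.lift.{max u v} #M ≤ c := self_le_add_left _ _
  have hlist : Cardinal.lift.{max u v} #(List M) ≤ c := by
    refine (Cardinal.lift_le.2 (mk_list_le_max M)).trans ?_
    rw [Cardinal.lift_max, lift_aleph0]
    exact max_le h0 hM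
  have hform (m : ℕ) : Cardinal.lift.{w} #(L.Formula (Fin n ⊕ Fin m)) ≤ c := by
    have h1 : #(L.Formula (Fin n ⊕ Fin m)) ≤ max ℵ₀ L.card := by
      refine (mk_le_of_injective (f := fun φ : L.Formula (Fin n ⊕ Fin m) =>
        (⟨0, φ⟩ : Σ k, L.BoundedFormula (Fin n ⊕ Fin m) k))
        fun _ _ h => eq_of_heq (Sigma.mk.inj h).2).trans ?_
      refine BoundedFormula.card_le.trans (max_le (le_max_left _ _) ?_)
      refine add_le_of_le (le_max_left _ _) ((lift_lt_aleph0.2 (lt_aleph0_of_finite _)).le.trans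
        (le_max_left _ _)) ?_
      rw [Cardinal.lift_id']
      exact le_max_right _ _
    refine (Cardinal.lift_le.2 h1).trans ?_
    rw [Cardinal.lift_max, lift_aleph0]
    exact max_le h0 hLc
  have hfam : Cardinal.lift.{w} #(Σ m : ℕ, L.Formula (Fin n ⊕ Fin m)) ≤ c := by
    rw [mk_sigma, Cardinal.lift_sum]
    refine (Cardinal.sum_le_sum _ (fun _ => c) hform).trans ?_
    rw [Cardinal.sum_const, Cardinal.lift_id', mk_nat, lift_aleph0]
    exact mul_le_of_le h0 h0 le_rfl
  let enc : InstanceIndex D Ψ → (Σ m : ℕ, L.Formula (Fin n ⊕ Fin m)) ×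
      List M × List M × List M := fun i =>
    (i.1.1, List.ofFn i.2.1.1, List.ofFn i.2.2.1.1, List.ofFn i.2.2.2)
  have henc : Function.Injective enc := by
    rintro ⟨ψ, a, b, t⟩ ⟨ψ', a', b', t'⟩ h
    simp only [enc, Prod.mk.injEq] at h
    obtain ⟨h1, h2, h3, h4⟩ := h
    obtain rfl : ψ = ψ' := Subtype.ext h1
    obtain rfl : a = a' := Subtype.ext (List.ofFn_injective h2)
    obtain rfl : b = b' := Subtype.ext (List.ofFn_injective h3)
    obtain rfl : t = t' := List.ofFn_injective h4
    rfl
  refine (mk_le_of_injective henc).trans ?_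
  simp only [mk_prod, Cardinal.lift_mul, Cardinal.lift_id]
  exact mul_le_of_le h0 hfam (mul_le_of_le h0 hlist (mul_le_of_le h0 hlist hlist))

theorem sameDeltaType_of_instances {Ψ : FormulaFamily L n} {g h : D.GStar j}
    (H : ∀ i : InstanceIndex D Ψ,
      i.1.1.2.Realize (Sum.elim (D.incl j i.2.1 * g * D.incl j i.2.2.1).1 (j ∘ i.2.2.2)) ↔
      i.1.1.2.Realize (Sum.elim (D.incl j i.2.1 * h * D.incl j i.2.2.1).1 (j ∘ i.2.2.2))) :
    D.SameDeltaType j Ψ g h := by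
  intro S hS
  induction hS using BooleanSubalgebra.closure_bot_sup_induction with
  | mem T hT =>
    obtain ⟨ψ, hψ, a, b, t, rfl⟩ := hT
    exact H ⟨⟨ψ, hψ⟩, a, b, t⟩
  | bot => exact Iff.rfl
  | sup _ _ _ _ hx hy => exact or_congr hx hy
  | compl _ _ hx => exact not_congr hx

/-- A subgroup such that elements of the same `Δ`-type lie in the same coset is of bounded index. -/
theorem mk_quotient_lt {κ : Cardinal.{w'}} (hC : IsMonster L C M κ) {Ψ : FormulaFamily L n}
    {H : Subgroup (D.GStar j)} (hH : ∀ a b, D.SameDeltaType j Ψ a b → a⁻¹ * b ∈ H) :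
    #(D.GStar j ⧸ H) < κ := by
  -- A coset is recorded by the instances true of its chosen representative, that is, by a Δ-type.
  let f : D.GStar j ⧸ H → Set (InstanceIndex D Ψ) := fun q => {i |
    i.1.1.2.Realize (Sum.elim (D.incl j i.2.1 * q.out * D.incl j i.2.2.1).1 (j ∘ i.2.2.2))}
  have hf : Function.Injective f := fun p q h => by
    have h1 := QuotientGroup.eq.2 (hH p.out q.out
      (sameDeltaType_of_instances fun i => Set.ext_iff.1 h i))
    rwa [QuotientGroup.out_eq', QuotientGroup.out_eq'] at h1
  have h1 := Cardinal.lift_mk_le_lift_mk_of_injective hf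
  rw [mk_set] at h1
  refine Cardinal.lift_lt.1 ((h1.trans (Cardinal.lift_le.2 ?_)).trans_lt hC.large)
  exact Cardinal.power_le_power_left two_ne_zero (mk_instanceIndex_le Ψ)

end Cardinals

/-! ### The connected component and its normality -/

section Subgroups

variable {κ : Cardinal.{w'}} {Ψ : FormulaFamily L n} {H : Subgroup (D.GStar j)}
  {T : Set (D.GStar j)}

theorem inter_mem_deltaNhds {S : Set (D.GStar j)} (hS : S ∈ deltaNhds Ψ H)
    (hT : T ∈ deltaNhds Ψ H) : S ∩ T ∈ deltaNhds Ψ H :=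
  ⟨hS.1.inter hT.1, Set.subset_inter hS.2 hT.2⟩

/-- Otherwise every `S` contains a bad triple. The sets `S` are closed under intersection and have
intersection `H`, so saturation gives a bad triple in `H`, which is absurd for a subgroup. -/
theorem exists_deltaNhds_inv_mul_mul (hC : IsMonster L C M κ)
    (hH : D.IsDeltaTypeDefinable j Ψ (H : Set (D.GStar j))) (hT : T ∈ deltaNhds Ψ H) :
    ∃ S ∈ deltaNhds Ψ H, ∀ x ∈ S, ∀ y ∈ S, ∀ z ∈ S, x⁻¹ * y * z ∈ T := by
  by_contra! hne
  -- The coordinates stand for `x`, `y`, `z`, `y * z`, `x⁻¹ * y * z`.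
  let R : deltaNhds Ψ H → Set (Fin 5 → D.GStar j) := fun S =>
    {x | x 0 ∈ S.1 ∧ x 1 ∈ S.1 ∧ x 2 ∈ S.1 ∧ x 1 * x 2 = x 3 ∧ x 0 * x 4 = x 3 ∧ x 4 ∈ Tᶜ}
  have : Nonempty (deltaNhds Ψ H) := ⟨⟨T, hT⟩⟩
  obtain ⟨x, hx⟩ := DefRel.saturation_directed hC.saturated hC.mk_range_lt R
    (fun S => (S.2.1.defOver.mem 0).inter ((S.2.1.defOver.mem 1).inter ((S.2.1.defOver.mem 2).inter
      ((DefRel.mul 1 2 3).inter ((DefRel.mul 0 4 3).inter (hT.1.compl.defOver.mem 4))))))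
    (fun S S' => ⟨⟨_, inter_mem_deltaNhds S.2 S'.2⟩,
      fun x hx => ⟨hx.1.1, hx.2.1.1, hx.2.2.1.1, hx.2.2.2⟩,
      fun x hx => ⟨hx.1.2, hx.2.1.2, hx.2.2.1.2, hx.2.2.2⟩⟩)
    (fun S => by
      obtain ⟨x, hx, y, hy, z, hz, h⟩ := hne S.1 S.2
      exact ⟨![x, y, z, y * z, x⁻¹ * y * z], hx, hy, hz, rfl,
        by simp only [Matrix.cons_val]; group, h⟩)
  rw [Set.mem_iInter] at hx
  have hmem : ∀ i : Fin 5, (∀ S : deltaNhds Ψ H, x i ∈ S.1) → x i ∈ H := by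
    intro i hi
    by_contra hiH
    obtain ⟨S, hS, hHS, hiS⟩ := isDeltaTypeDefinable_iff.1 hH _ hiH
    exact hiS (hi ⟨S, hS, hHS⟩)
  have h0 := hmem 0 fun S => (hx S).1
  have h1 := hmem 1 fun S => (hx S).2.1
  have h2 := hmem 2 fun S => (hx S).2.2.1
  obtain ⟨-, -, -, h3, h4, h5⟩ := hx ⟨T, hT⟩
  refine h5 (hT.2 ?_)
  rw [← h3] at h4
  rw [eq_inv_mul_of_mul_eq h4]
  exact H.mul_mem (H.inv_mem h0) (H.mul_mem h1 h2)

/-- Finitely many translates of `T` by elements of `G` cover `G*`, for any definable set `T`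
containing a subgroup of bounded index. -/
theorem exists_finite_cover (hC : IsMonster L C M κ) (hH : #(D.GStar j ⧸ H) < κ)
    (hT : T ∈ deltaNhds Ψ H) :
    ∃ (m : ℕ) (a : Fin m → D.G), ∀ g, ∃ i, (D.incl j (a i))⁻¹ * g ∈ T := by
  have hs : ∃ s : Finset (D.GStar j ⧸ H), ∀ g, ∃ q ∈ s, (q.out)⁻¹ * g ∈ T := by
    by_contra! hne
    -- Bounded index keeps this parameter set smaller than `κ`. If no finite set of representatives
    -- sufficed, saturation over it would give an element outside every translate, including that of
    -- its own coset.
    let A : Set C := Set.range j ∪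
      Set.range fun p : (D.GStar j ⧸ H) × Fin n => ((p.1.out)⁻¹ : D.GStar j).1 p.2
    have hA : #A < κ := by
      refine (mk_union_le _ _).trans_lt (add_lt_of_lt hC.aleph0_lt.le hC.mk_range_lt ?_)
      refine mk_range_le.trans_lt ?_
      rw [mk_prod]
      refine mul_lt_of_lt hC.aleph0_lt.le (by simpa using hH) ?_
      exact (lift_lt_aleph0.2 (lt_aleph0_of_finite _)).trans hC.aleph0_lt
    obtain ⟨x, hx⟩ := DefRel.saturation_directed hC.saturated hA
      (fun s : Finset (D.GStar j ⧸ H) =>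
        {x : Unit → D.GStar j | ∀ q ∈ s, (q.out)⁻¹ * x () ∈ Tᶜ})
      (fun s => by
        have h1 (q : D.GStar j ⧸ H) :
            D.DefRel j A {x : Unit → D.GStar j | (q.out)⁻¹ * x () ∈ Tᶜ} := by
          have h2 := DefOver.translate (hT.1.compl.defOver.mono
            (Set.subset_union_left : Set.range j ⊆ A)) (a := (q.out)⁻¹) (b := D.incl j 1)
            (fun c ⟨i, hi⟩ => Or.inr ⟨(q, i), hi⟩)
            ((range_incl_subset 1).trans Set.subset_union_left)
          simp only [map_one, mul_one] at h2
          exact h2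
        induction s using Finset.cons_induction with
        | empty => simpa using! DefRel.univ
        | cons q s hq ih =>
          simp only [Finset.forall_mem_cons]
          exact (h1 q).inter ih)
      (fun s t => by
        classical
        exact ⟨s ∪ t, fun x hx q hq => hx q (Finset.mem_union_left _ hq),
          fun x hx q hq => hx q (Finset.mem_union_right _ hq)⟩)
      (fun s => (hne s).imp' (fun g _ => g) fun g hg => hg)
    rw [Set.mem_iInter] at hx
    refine hx {(x () : D.GStar j ⧸ H)} _ (Finset.mem_singleton_self _) (hT.2 ?_)
    exact QuotientGroup.eq.1 (QuotientGroup.out_eq' _)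
  obtain ⟨s, hs⟩ := hs
  -- With the number of translates fixed, covering `G*` is a property of the tuple definable over
  -- `M`, so some tuple from `G` has it.
  let R : Set (Fin s.card → D.GStar j) := {x | ∀ g, ∃ i, (x i)⁻¹ * g ∈ T}
  have hR : D.DefRel j (Set.range j) R := by
    have h1 : D.DefRel j (Set.range j) {x : Fin s.card ⊕ Unit ⊕ Fin s.card → D.GStar j |
        ∀ i, x (.inl i) * x (.inr (.inr i)) = x (.inr (.inl ())) ∧ x (.inr (.inr i)) ∈ Tᶜ} := by
      rw [Set.ofPred_forall]
      exact DefRel.iInter fun i => (DefRel.mul _ _ _).inter (hT.1.compl.defOver.mem _)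
    convert! (h1.image Sum.inl).compl using 1
    ext x
    rw [Set.mem_compl_iff, Set.mem_ofPred_eq, Set.mem_ofPred_eq, ← not_iff_not, not_not]
    push Not
    constructor
    · rintro ⟨g, hg⟩
      exact ⟨Sum.elim x (Sum.elim (fun _ => g) fun i => (x i)⁻¹ * g),
        fun i => ⟨mul_inv_cancel_left _ _, hg i⟩, rfl⟩
    · rintro ⟨y, hy, rfl⟩
      refine ⟨y (.inr (.inl ())), fun i => ?_⟩
      rw [Function.comp, ← (hy i).1, inv_mul_cancel_left]
      exact (hy i).2
  obtain ⟨y, hy⟩ := hR.exists_incl_mem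
    ⟨fun i => (s.equivFin.symm i).1.out, fun g => by
      obtain ⟨q, hq, h⟩ := hs g
      exact ⟨s.equivFin ⟨q, hq⟩, by simpa using h⟩⟩
  exact ⟨_, y, hy⟩

/-- A translate `cS` with `c ∈ G` is Δ-definable over `M`, so it contains both `a` and `b` or
neither; some such translate contains `a`. -/
theorem inv_mul_mem_of_sameDeltaType (hC : IsMonster L C M κ) (hH : H ∈ D.boundedSubgroups j Ψ κ)
    {a b : D.GStar j} (hab : D.SameDeltaType j Ψ a b) : a⁻¹ * b ∈ H := by
  by_contra hn
  obtain ⟨T, hT, hHT, hnT⟩ := isDeltaTypeDefinable_iff.1 hH.1 _ hn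
  obtain ⟨S, hS, hST⟩ := exists_deltaNhds_inv_mul_mul hC hH.1 ⟨hT, hHT⟩
  obtain ⟨m, c, hc⟩ := exists_finite_cover hC hH.2 hS
  obtain ⟨i, hi⟩ := hc a
  have h1 := hab _ (hS.1.translate (c i)⁻¹ 1)
  simp only [map_inv, map_one, mul_one, Set.mem_ofPred_eq] at h1
  have h2 := hST _ hi _ (h1.1 hi) 1 (hS.2 H.one_mem)
  refine hnT ?_
  convert h2 using 1
  group

theorem isLeast_component (hC : IsMonster L C M κ) :
    IsLeast (D.boundedSubgroups j Ψ κ) (D.component j Ψ κ) := by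
  refine ⟨⟨isDeltaTypeDefinable_iff.2 fun g hg => ?_, ?_⟩, fun H hH => sInf_le hH⟩
  · rw [SetLike.mem_coe, component, Subgroup.mem_sInf] at hg
    push Not at hg
    obtain ⟨H, hH, hgH⟩ := hg
    obtain ⟨T, hT, hHT, hgT⟩ := isDeltaTypeDefinable_iff.1 hH.1 g hgH
    exact ⟨T, hT, fun x hx => hHT (sInf_le hH hx), hgT⟩
  · exact mk_quotient_lt hC fun a b hab =>
      Subgroup.mem_sInf.2 fun H hH => inv_mul_mem_of_sameDeltaType hC hH hab

/-- Conjugation by an element of `G` preserves Δ-definability, hence also equality of Δ-types; the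
latter yields the bound on the index. -/
theorem comap_conj_incl_mem_boundedSubgroups (hC : IsMonster L C M κ)
    (hH : H ∈ D.boundedSubgroups j Ψ κ) (a : D.G) :
    H.comap (MulAut.conj (D.incl j a)).toMonoidHom ∈ D.boundedSubgroups j Ψ κ := by
  refine ⟨isDeltaTypeDefinable_iff.2 fun g hg => ?_, mk_quotient_lt hC (Ψ := Ψ) ?_⟩
  · obtain ⟨T, hT, hHT, hgT⟩ := isDeltaTypeDefinable_iff.1 hH.1 _ hg
    refine ⟨_, hT.translate a a⁻¹, fun x hx => ?_, ?_⟩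
    · simpa using hHT hx
    · simpa using hgT
  · intro x y hxy
    have h : D.SameDeltaType j Ψ (D.incl j a * x * D.incl j a⁻¹) (D.incl j a * y * D.incl j a⁻¹) :=
      fun S hS => hxy _ (hS.translate a a⁻¹)
    have h1 := inv_mul_mem_of_sameDeltaType hC hH h
    rw [Subgroup.mem_comap]
    convert h1 using 1
    simp only [MulEquiv.coe_toMonoidHom, MulAut.conj_apply, map_inv]
    group

theorem conj_incl_mem_component (hC : IsMonster L C M κ) (a : D.G) {h : D.GStar j}
    (hh : h ∈ D.component j Ψ κ) :
    D.incl j a * h * (D.incl j a)⁻¹ ∈ D.component j Ψ κ :=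
  (isLeast_component hC).2
    (comap_conj_incl_mem_boundedSubgroups hC (isLeast_component hC).1 a) hh

theorem exists_eq_inv_mul_incl (hC : IsMonster L C M κ) (hH : #(D.GStar j ⧸ H) < κ)
    (hT : T ∈ deltaNhds Ψ H) (g : D.GStar j) : ∃ p ∈ T, ∃ a : D.G, g = p⁻¹ * D.incl j a := by
  obtain ⟨m, c, hc⟩ := exists_finite_cover hC hH hT
  obtain ⟨i, hi⟩ := hc g⁻¹
  exact ⟨_, hi, (c i)⁻¹, by rw [map_inv]; group⟩

/-- For `g = p⁻¹a`, the conjugate `g h g⁻¹` equals `p⁻¹(a h a⁻¹)p`, which lies in `S⁻¹SS` since `a h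
a⁻¹` is in the component. -/
theorem normal_component (hC : IsMonster L C M κ) : (D.component j Ψ κ).Normal := by
  refine ⟨fun h hh g => ?_⟩
  have hb := (isLeast_component (D := D) (j := j) (Ψ := Ψ) hC).1
  by_contra hn
  obtain ⟨T, hT, hHT, hnT⟩ := isDeltaTypeDefinable_iff.1 hb.1 _ hn
  obtain ⟨S, hS, hST⟩ := exists_deltaNhds_inv_mul_mul hC hb.1 ⟨hT, hHT⟩
  obtain ⟨p, hp, a, rfl⟩ := exists_eq_inv_mul_incl hC hb.2 hS g
  have h1 := hST p hp _ (hS.2 (conj_incl_mem_component hC a hh)) p hp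
  refine hnT ?_
  convert h1 using 1
  group

end Subgroups

end DefinableGroup

end DeltaBohr

namespace DeltaBohr

namespace DefinableGroup

variable {L : FirstOrder.Language.{u, v}} {M : Type w} [L.Structure M] {n : ℕ}
  {D : DefinableGroup L M n} {C : Type w'} [L.Structure C] {j : M ↪ₑ[L] C}

/-! ### Passing between `G` and `G*` -/

section Traces

variable {Ψ : FormulaFamily L n}

theorem realize_incl_iff {m : ℕ} (ψ : L.Formula (Fin n ⊕ Fin m)) (g : D.G) (t : Fin m → M) :
    ψ.Realize (Sum.elim (D.incl j g).1 (j ∘ t)) ↔ ψ.Realize (Sum.elim g.1 t) := by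
  rw [← j.map_formula ψ, Sum.comp_elim]
  rfl

theorem IsDeltaDefinableStar.preimage_incl {S : Set (D.GStar j)}
    (hS : D.IsDeltaDefinableStar j Ψ S) : D.IsDeltaDefinable Ψ (D.incl j ⁻¹' S) := by
  induction hS using BooleanSubalgebra.closure_bot_sup_induction with
  | mem T hT =>
    obtain ⟨ψ, hψ, a, b, t, rfl⟩ := hT
    refine BooleanSubalgebra.subset_closure ⟨ψ, hψ, a, b, t, ?_⟩
    ext g
    simp only [Set.mem_preimage, Set.mem_ofPred_eq, ← map_mul, realize_incl_iff]
  | bot => exact BooleanSubalgebra.bot_mem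
  | sup _ _ _ _ hx hy => exact BooleanSubalgebra.supClosed _ hx hy
  | compl _ _ hx => exact BooleanSubalgebra.compl_mem hx

theorem IsDeltaDefinable.exists_star {S : Set D.G} (hS : D.IsDeltaDefinable Ψ S) :
    ∃ T : Set (D.GStar j), D.IsDeltaDefinableStar j Ψ T ∧ D.incl j ⁻¹' T = S := by
  induction hS using BooleanSubalgebra.closure_bot_sup_induction with
  | mem T hT =>
    obtain ⟨ψ, hψ, a, b, t, rfl⟩ := hT
    refine ⟨_, BooleanSubalgebra.subset_closure ⟨ψ, hψ, a, b, t, rfl⟩, ?_⟩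
    ext g
    simp only [Set.mem_preimage, Set.mem_ofPred_eq, ← map_mul, realize_incl_iff]
  | bot => exact ⟨∅, .empty, rfl⟩
  | sup _ _ _ _ hx hy =>
    obtain ⟨X, hX, rfl⟩ := hx
    obtain ⟨Y, hY, rfl⟩ := hy
    exact ⟨X ∪ Y, hX.union hY, rfl⟩
  | compl _ _ hx =>
    obtain ⟨X, hX, rfl⟩ := hx
    exact ⟨Xᶜ, hX.compl, rfl⟩

theorem DefOver.exists_incl_mem {S : Set (D.GStar j)} (hS : DefOver (Set.range j) S)
    (hne : S.Nonempty) : ∃ g : D.G, D.incl j g ∈ S :=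
  let ⟨x, hx⟩ := hne
  let ⟨y, hy⟩ := DefRel.exists_incl_mem hS ⟨fun _ => x, hx⟩
  ⟨y (), hy⟩

end Traces

/-! ### The Δ-topology on `G*` and the logic topology on the quotient -/

section Topology

open TopologicalSpace Topology Filter

/-- The topology on `G*` whose closed sets are the sets `Δ`-type-definable over `M`. -/
@[reducible]
def deltaTopology (D : DefinableGroup L M n) (j : M ↪ₑ[L] C) (Ψ : FormulaFamily L n) :
    TopologicalSpace (D.GStar j) :=
  generateFrom {S | D.IsDeltaDefinableStar j Ψ S}

variable {κ : Cardinal.{w'}} {Ψ : FormulaFamily L n}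

/-- An ultrafilter converges to any point lying in all of its members definable over `M`; saturation
provides one. A general `B` covers both the Δ-topology and the topology of all definable sets. -/
theorem compactSpace_generateFrom (hC : IsMonster L C M κ) {B : Set (Set (D.GStar j))}
    (hB : ∀ S ∈ B, DefOver (Set.range j) S) : @CompactSpace _ (generateFrom B) := by
  let := generateFrom B
  refine ⟨isCompact_iff_ultrafilter_le_nhds.2 fun U _ => ?_⟩
  let ι := {S : Set (D.GStar j) // DefOver (Set.range j) S ∧ S ∈ U}
  have : Nonempty ι := ⟨⟨Set.univ, DefRel.univ, univ_mem⟩⟩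
  obtain ⟨x, hx⟩ := DefRel.saturation_directed hC.saturated hC.mk_range_lt
    (fun S : ι => {x : Unit → D.GStar j | x () ∈ S.1}) (fun S => S.2.1)
    (fun S T => ⟨⟨S.1 ∩ T.1, DefRel.inter S.2.1 T.2.1, inter_mem S.2.2 T.2.2⟩,
      fun x hx => hx.1, fun x hx => hx.2⟩)
    (fun S => let ⟨g, hg⟩ := U.nonempty_of_mem S.2.2; ⟨fun _ => g, hg⟩)
  rw [Set.mem_iInter] at hx
  refine ⟨x (), Set.mem_univ _, ?_⟩
  rw [nhds_generateFrom]
  refine le_iInf₂ fun S hS => le_principal_iff.2 ?_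
  by_contra hSU
  exact hx ⟨Sᶜ, DefRel.compl (hB S hS.2), Ultrafilter.compl_mem_iff_notMem.2 hSU⟩ hS.1

theorem isTopologicalBasis_deltaTopology :
    @IsTopologicalBasis _ (D.deltaTopology j Ψ) {S | D.IsDeltaDefinableStar j Ψ S} := by
  let := D.deltaTopology j Ψ
  have h := isTopologicalBasis_of_subbasis_of_inter (r := {S | D.IsDeltaDefinableStar j Ψ S}) rfl
    fun S hS T hT => hS.inter hT
  have hu : Set.univ ∈ {S | D.IsDeltaDefinableStar j Ψ S} := IsDeltaDefinableStar.univ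
  rwa [Set.insert_eq_of_mem hu] at h

theorem isOpen_deltaTopology_iff {U : Set (D.GStar j)} :
    IsOpen[D.deltaTopology j Ψ] U ↔
      ∀ g ∈ U, ∃ S, D.IsDeltaDefinableStar j Ψ S ∧ g ∈ S ∧ S ⊆ U :=
  let := D.deltaTopology j Ψ
  isTopologicalBasis_deltaTopology.isOpen_iff

theorem isClosed_deltaTopology_iff {Z : Set (D.GStar j)} :
    IsClosed[D.deltaTopology j Ψ] Z ↔ D.IsDeltaTypeDefinable j Ψ Z := by
  let := D.deltaTopology j Ψ
  rw [← isOpen_compl_iff, isOpen_deltaTopology_iff, isDeltaTypeDefinable_iff]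
  refine forall₂_congr fun g hg => ⟨?_, ?_⟩
  · rintro ⟨S, hS, hgS, hSZ⟩
    exact ⟨Sᶜ, hS.compl, Set.subset_compl_comm.1 hSZ, fun h => h hgS⟩
  · rintro ⟨S, hS, hZS, hgS⟩
    exact ⟨Sᶜ, hS.compl, hgS, Set.compl_subset_compl.2 hZS⟩

/-- Disjoint `Δ`-type-definable sets are separated by a `Δ`-definable set. -/
theorem exists_isDeltaDefinableStar_separating (hC : IsMonster L C M κ) {X Y : Set (D.GStar j)}
    (hX : IsClosed[D.deltaTopology j Ψ] X) (hY : IsClosed[D.deltaTopology j Ψ] Y)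
    (hXY : Disjoint X Y) : ∃ S, D.IsDeltaDefinableStar j Ψ S ∧ X ⊆ S ∧ Disjoint S Y := by
  let := D.deltaTopology j Ψ
  have : CompactSpace (D.GStar j) :=
    compactSpace_generateFrom hC fun S (hS : D.IsDeltaDefinableStar j Ψ S) => hS.defOver
  refine hX.isCompact.induction_on
    (p := fun X => ∃ S, D.IsDeltaDefinableStar j Ψ S ∧ X ⊆ S ∧ Disjoint S Y)
    ⟨∅, .empty, subset_rfl, Set.empty_disjoint _⟩
    (fun X X' h ⟨S, hS, hXS, hSY⟩ => ⟨S, hS, h.trans hXS, hSY⟩) ?_ ?_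
  · rintro X X' ⟨S, hS, hXS, hSY⟩ ⟨S', hS', hXS', hSY'⟩
    exact ⟨S ∪ S', hS.union hS', Set.union_subset_union hXS hXS', hSY.union_left hSY'⟩
  · intro g hg
    obtain ⟨S, hS, hgS, hSY⟩ := isOpen_deltaTopology_iff.1 hY.isOpen_compl g
      (Set.disjoint_left.1 hXY hg)
    exact ⟨S, mem_nhdsWithin_of_mem_nhds ((isTopologicalBasis_deltaTopology.isOpen hS).mem_nhds hgS),
      S, hS, subset_rfl, Set.subset_compl_iff_disjoint_right.1 hSY⟩

theorem isClosed_logicTopology_iff {H : Subgroup (D.GStar j)} {Z : Set (D.GStar j ⧸ H)} :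
    IsClosed Z ↔ D.IsTypeDefinable j ((fun g : D.GStar j => (g : D.GStar j ⧸ H)) ⁻¹' Z) := by
  rw [← isOpen_compl_iff]
  change Zᶜᶜ ∈ _ ↔ _
  rw [compl_compl]
  rfl

theorem compactSpace_logicTopology (hC : IsMonster L C M κ) (H : Subgroup (D.GStar j)) :
    CompactSpace (D.GStar j ⧸ H) := by
  let t : TopologicalSpace (D.GStar j) := generateFrom {S | DefOver (Set.range j) S}
  have h1 := compactSpace_generateFrom (D := D) (j := j) hC (B := {S | DefOver (Set.range j) S})
    fun S hS => hS
  have h2 : @Continuous _ _ t (logicTopology D j H) (fun g : D.GStar j => (g : D.GStar j ⧸ H)) := by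
    refine (@continuous_iff_isClosed _ _ t (logicTopology D j H) _).2 fun Z hZ => ?_
    obtain ⟨F, hF, e⟩ := isClosed_logicTopology_iff.1 hZ
    rw [e]
    refine isClosed_sInter fun S hS => ?_
    refine isOpen_compl_iff.1 (isOpen_generateFrom_of_mem ?_)
    exact DefRel.compl (defOver_iff.2 (hF S hS))
  exact @Function.Surjective.compactSpace _ _ t (logicTopology D j H) _ h2 h1
    QuotientGroup.mk_surjective

variable {H : Subgroup (D.GStar j)} [H.Normal]

/-- The images of the `Δ`-definable sets containing `H`, as a basis of neighbourhoods of `1` in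
`G* ⧸ H`. -/
@[reducible]
def quotientFilterBasis (hC : IsMonster L C M κ) (hH : H ∈ D.boundedSubgroups j Ψ κ) :
    GroupFilterBasis (D.GStar j ⧸ H) where
  sets := {U | ∃ T ∈ deltaNhds Ψ H, U = (fun g : D.GStar j => (g : D.GStar j ⧸ H)) '' T}
  nonempty := ⟨_, Set.univ, ⟨.univ, Set.subset_univ _⟩, rfl⟩
  inter_sets := by
    rintro _ _ ⟨S, hS, rfl⟩ ⟨T, hT, rfl⟩
    exact ⟨_, ⟨_, inter_mem_deltaNhds hS hT, rfl⟩, Set.image_inter_subset _ _ _⟩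
  one' := by
    rintro _ ⟨T, hT, rfl⟩
    exact ⟨1, hT.2 H.one_mem, rfl⟩
  mul' := by
    rintro _ ⟨T, hT, rfl⟩
    obtain ⟨S, hS, hST⟩ := exists_deltaNhds_inv_mul_mul hC hH.1 hT
    refine ⟨_, ⟨S, hS, rfl⟩, ?_⟩
    rintro _ ⟨_, ⟨x, hx, rfl⟩, _, ⟨y, hy, rfl⟩, rfl⟩
    exact ⟨x * y, by simpa using hST 1 (hS.2 H.one_mem) x hx y hy, rfl⟩
  inv' := by
    rintro _ ⟨T, hT, rfl⟩
    obtain ⟨S, hS, hST⟩ := exists_deltaNhds_inv_mul_mul hC hH.1 hT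
    refine ⟨_, ⟨S, hS, rfl⟩, ?_⟩
    rintro _ ⟨x, hx, rfl⟩
    exact ⟨x⁻¹, by simpa using hST x hx 1 (hS.2 H.one_mem) 1 (hS.2 H.one_mem), rfl⟩
  conj' := by
    rintro g _ ⟨T, hT, rfl⟩
    obtain ⟨g, rfl⟩ := QuotientGroup.mk_surjective g
    obtain ⟨S, hS, hST⟩ := exists_deltaNhds_inv_mul_mul hC hH.1 hT
    -- Conjugating `a⁻¹Sa` by `p⁻¹a` lands in `p⁻¹Sp ⊆ T`.
    obtain ⟨p, hp, a, rfl⟩ := exists_eq_inv_mul_incl hC hH.2 hS g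
    refine ⟨_, ⟨_, ⟨hS.1.translate a a⁻¹, fun h hh => hS.2 ?_⟩, rfl⟩, ?_⟩
    · rw [map_inv]
      exact Subgroup.Normal.conj_mem ‹_› h hh _
    · rintro _ ⟨x, hx, rfl⟩
      refine ⟨_, hST p hp _ hx p hp, ?_⟩
      simp only [← QuotientGroup.mk_mul, ← QuotientGroup.mk_inv]
      congr 1
      simp only [map_inv]
      group

/-- The set `gT` need not be Δ-definable over `M`, but a translate `cS` with `c ∈ G` satisfies `g ∈
cS ⊆ gT`. -/
theorem isOpen_preimage_of_isOpen_quotientFilterBasis (hC : IsMonster L C M κ)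
    (hH : H ∈ D.boundedSubgroups j Ψ κ) {U : Set (D.GStar j ⧸ H)}
    (hU : IsOpen[(quotientFilterBasis hC hH).topology] U) :
    IsOpen[D.deltaTopology j Ψ] ((fun g : D.GStar j => (g : D.GStar j ⧸ H)) ⁻¹' U) := by
  refine isOpen_deltaTopology_iff.2 fun g hg => ?_
  have h1 := @IsOpen.mem_nhds _ (quotientFilterBasis hC hH).topology (g : D.GStar j ⧸ H) U hU hg
  obtain ⟨_, ⟨T, hT, rfl⟩, hTU⟩ :=
    ((quotientFilterBasis hC hH).nhds_hasBasis (g : D.GStar j ⧸ H)).mem_iff.1 h1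
  obtain ⟨S, hS, hST⟩ := exists_deltaNhds_inv_mul_mul hC hH.1 hT
  obtain ⟨m, c, hc⟩ := exists_finite_cover hC hH.2 hS
  obtain ⟨i, hi⟩ := hc g
  refine ⟨_, hS.1.translate (c i)⁻¹ 1, ?_, fun x hx => hTU ?_⟩
  · simpa using hi
  · simp only [map_inv, map_one, mul_one, Set.mem_ofPred_eq] at hx
    refine ⟨_, ⟨_, hST _ hi _ hx 1 (hS.2 H.one_mem), rfl⟩, ?_⟩
    simp only [← QuotientGroup.mk_mul]
    congr 1
    group

theorem t2Space_quotientFilterBasis (hC : IsMonster L C M κ)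
    (hH : H ∈ D.boundedSubgroups j Ψ κ) : @T2Space _ (quotientFilterBasis hC hH).topology := by
  let t := (quotientFilterBasis hC hH).topology
  have : @IsTopologicalGroup _ t _ := (quotientFilterBasis hC hH).isTopologicalGroup
  refine @IsTopologicalGroup.t2Space_of_one_sep _ t _ this fun q hq => ?_
  obtain ⟨g, rfl⟩ := QuotientGroup.mk_surjective q
  have hgH : g ∉ H := fun h => hq ((QuotientGroup.eq_one_iff g).2 h)
  obtain ⟨T, hT, hHT, hgT⟩ := isDeltaTypeDefinable_iff.1 hH.1 g hgH
  obtain ⟨S, hS, hST⟩ := exists_deltaNhds_inv_mul_mul hC hH.1 ⟨hT, hHT⟩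
  refine ⟨_, (quotientFilterBasis hC hH).mem_nhds_one ⟨S, hS, rfl⟩, ?_⟩
  rintro ⟨x, hx, e⟩
  refine hgT ?_
  have h1 := hST 1 (hS.2 H.one_mem) x hx _ (hS.2 (QuotientGroup.eq.1 e))
  simpa using h1

/-- The identity from the compact logic topology to the Hausdorff group topology is continuous,
hence closed. -/
theorem logicTopology_eq (hC : IsMonster L C M κ) (hH : H ∈ D.boundedSubgroups j Ψ κ) :
    logicTopology D j H = (quotientFilterBasis hC hH).topology := by
  have hle : logicTopology D j H ≤ (quotientFilterBasis hC hH).topology := by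
    intro U hU
    have h1 := isOpen_preimage_of_isOpen_quotientFilterBasis hC hH hU
    have h2 : @IsClosed _ (logicTopology D j H) Uᶜ := by
      refine isClosed_logicTopology_iff.2 (IsDeltaTypeDefinable.isTypeDefinable (Ψ := Ψ) ?_)
      refine isClosed_deltaTopology_iff.1 ?_
      exact (@isClosed_compl_iff _ (D.deltaTopology j Ψ) _).2 h1
    exact (@isClosed_compl_iff _ (logicTopology D j H) _).1 h2
  have h1 := @Continuous.isClosedMap _ _ (logicTopology D j H)
    (quotientFilterBasis hC hH).topology (compactSpace_logicTopology hC H)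
    (t2Space_quotientFilterBasis hC hH) id (continuous_id_of_le hle)
  refine le_antisymm hle fun U hU => ?_
  have h2 := h1 Uᶜ ((@isClosed_compl_iff _ (logicTopology D j H) _).2 hU)
  rw [Set.image_id] at h2
  exact (@isClosed_compl_iff _ (quotientFilterBasis hC hH).topology _).1 h2

/-- The logic topology asks only for type-definability by arbitrary formulas; its agreement with the
group topology upgrades this to Δ-type-definability. -/
theorem isClosed_preimage_mk (hC : IsMonster L C M κ) (hH : H ∈ D.boundedSubgroups j Ψ κ)
    {Z : Set (D.GStar j ⧸ H)} (hZ : IsClosed Z) :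
    IsClosed[D.deltaTopology j Ψ] ((fun g : D.GStar j => (g : D.GStar j ⧸ H)) ⁻¹' Z) := by
  have h1 := hZ.isOpen_compl
  rw [logicTopology_eq hC hH] at h1
  exact (@isOpen_compl_iff _ _ (D.deltaTopology j Ψ)).1
    (isOpen_preimage_of_isOpen_quotientFilterBasis hC hH h1)

theorem isDeltaCompactification_natural (hC : IsMonster L C M κ)
    (hH : H ∈ D.boundedSubgroups j Ψ κ) : D.IsDeltaCompactification Ψ (D.natural j H) where
  isTopologicalGroup := by
    rw [logicTopology_eq hC hH]
    exact (quotientFilterBasis hC hH).isTopologicalGroup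
  compactSpace := compactSpace_logicTopology hC H
  t2Space := by
    rw [logicTopology_eq hC hH]
    exact t2Space_quotientFilterBasis hC hH
  isDeltaDefinableMap := by
    intro X Y hX hY hXY
    obtain ⟨S, hS, hXS, hSY⟩ := exists_isDeltaDefinableStar_separating hC
      (isClosed_preimage_mk hC hH hX) (isClosed_preimage_mk hC hH hY) (hXY.preimage _)
    exact ⟨_, hS.preimage_incl, fun g hg => hXS hg, Set.disjoint_left.2 fun g hgS hgY =>
      Set.disjoint_left.1 hSY hgS hgY⟩
  denseRange := by
    rw [DenseRange, dense_iff_inter_open]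
    rintro U hU ⟨q, hq⟩
    obtain ⟨g, rfl⟩ := QuotientGroup.mk_surjective q
    have h1 := isClosed_preimage_mk hC hH hU.isClosed_compl
    obtain ⟨S, hS, hgS, hSU⟩ := isOpen_deltaTopology_iff.1
      ((@isOpen_compl_iff _ _ (D.deltaTopology j Ψ)).2 h1) g (fun h => h hq)
    obtain ⟨a, ha⟩ := hS.defOver.exists_incl_mem ⟨g, hgS⟩
    exact ⟨_, not_not.1 (hSU ha), a, rfl⟩

end Topology

end DefinableGroup

end DeltaBohr

/-! ### Extending compactifications to `G*` and factoring them -/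

namespace DeltaBohr

namespace DefinableGroup

open TopologicalSpace Topology Filter

variable {L : FirstOrder.Language.{u, v}} {M : Type w} [L.Structure M] {n : ℕ}
  {D : DefinableGroup L M n} {C : Type w'} [L.Structure C] {j : M ↪ₑ[L] C}
  {κ : Cardinal.{w'}} {Ψ : FormulaFamily L n}
  {K : Type x} [Group K] [TopologicalSpace K] {f : D.G →* K}

theorem denseRange_incl : @DenseRange _ (D.deltaTopology j Ψ) _ (D.incl j) := by
  let := D.deltaTopology j Ψ
  rw [DenseRange, dense_iff_inter_open]
  rintro U hU ⟨g, hg⟩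
  obtain ⟨S, hS, hgS, hSU⟩ := isOpen_deltaTopology_iff.1 hU g hg
  obtain ⟨a, ha⟩ := hS.defOver.exists_incl_mem ⟨g, hgS⟩
  exact ⟨_, hSU ha, a, rfl⟩

namespace IsDeltaCompactification

/-- Compactness gives a cluster point `k`. To see that it is the limit, a closed neighbourhood of
`k` is separated from the complement of a larger open one by a Δ-definable set; the Δ-type of `g`
decides that set, and clustering at `k` excludes the wrong answer. -/
theorem exists_tendsto (hf : D.IsDeltaCompactification Ψ f) (g : D.GStar j) :
    ∃ k, Tendsto f (comap (D.incl j) (@nhds _ (D.deltaTopology j Ψ) g)) (𝓝 k) := by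
  let := D.deltaTopology j Ψ
  have := hf.compactSpace
  have := hf.t2Space
  have hne : NeBot (comap (D.incl j) (𝓝 g)) := comap_neBot fun U hU => by
    obtain ⟨_, hx, a, rfl⟩ := mem_closure_iff_nhds.1 (denseRange_incl (Ψ := Ψ) g) U hU
    exact ⟨a, hx⟩
  obtain ⟨k, hk⟩ := exists_clusterPt_of_compactSpace (map f (comap (D.incl j) (𝓝 g)))
  refine ⟨k, fun U hU => ?_⟩
  obtain ⟨Z, hZ, hZc, hZU⟩ := exists_mem_nhds_isClosed_subset (interior_mem_nhds.2 hU)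
  obtain ⟨S, hS, hZS, hSU⟩ := hf.isDeltaDefinableMap Z (interior U)ᶜ hZc
    isOpen_interior.isClosed_compl (Set.subset_compl_iff_disjoint_right.1 (by rwa [compl_compl]))
  obtain ⟨T, hT, rfl⟩ := hS.exists_star (j := j)
  by_cases hg : g ∈ T
  · refine ⟨T, (isTopologicalBasis_deltaTopology.isOpen hT).mem_nhds hg, fun a ha => ?_⟩
    by_contra haU
    exact Set.disjoint_left.1 hSU ha fun h => haU (interior_subset (s := U) h)
  · have h1 : Zᶜ ∈ map f (comap (D.incl j) (𝓝 g)) :=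
      ⟨Tᶜ, (isTopologicalBasis_deltaTopology.isOpen hT.compl).mem_nhds hg,
        fun a ha haZ => ha (hZS haZ)⟩
    obtain ⟨z, hz, hz'⟩ := clusterPt_iff_nonempty.1 hk hZ h1
    exact absurd hz hz'

/-- A `Δ`-definable compactification of `G` extends to a homomorphism on `G*`. -/
theorem exists_extension (hf : D.IsDeltaCompactification Ψ f) (j : M ↪ₑ[L] C) :
    ∃ F : D.GStar j →* K, (∀ g, F (D.incl j g) = f g) ∧
      @Continuous _ _ (D.deltaTopology j Ψ) _ F := by
  let := D.deltaTopology j Ψ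
  let : TopologicalSpace D.G := induced (D.incl j) (D.deltaTopology j Ψ)
  have := hf.isTopologicalGroup
  have := hf.compactSpace
  have := hf.t2Space
  have hdi : IsDenseInducing (D.incl j) := ⟨⟨rfl⟩, denseRange_incl⟩
  have hcont : Continuous f := continuous_iff_continuousAt.2 fun g => by
    obtain ⟨k, hk⟩ := hf.exists_tendsto (D.incl j g)
    rw [← hdi.nhds_eq_comap] at hk
    exact continuousAt_of_tendsto_nhds hk
  have hF := hdi.continuous_extend hf.exists_tendsto
  have hFf := hdi.extend_eq hcont
  set F := hdi.extend f
  refine ⟨MonoidHom.mk' F fun g h => ?_, hFf, hF⟩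
  -- Joint continuity of multiplication in the Δ-topology is not available. Instead, a failure at
  -- `(g, h)` holds on a relation definable over `M`, so it reappears at a pair from `G`, where `f`
  -- is multiplicative.
  by_contra hn
  obtain ⟨U, V, hU, hV, hgU, hgV, hUV⟩ := t2_separation hn
  obtain ⟨V₁, V₂, hV₁, hV₂, hgV₁, hgV₂, hVV⟩ :=
    isOpen_prod_iff.1 (hV.preimage continuous_mul) (F g) (F h) hgV
  obtain ⟨S₀, hS₀, hgS₀, hSV₀⟩ := isOpen_deltaTopology_iff.1 (hV₁.preimage hF) g hgV₁
  obtain ⟨S₁, hS₁, hgS₁, hSV₁⟩ := isOpen_deltaTopology_iff.1 (hV₂.preimage hF) h hgV₂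
  obtain ⟨S₂, hS₂, hgS₂, hSV₂⟩ := isOpen_deltaTopology_iff.1 (hU.preimage hF) (g * h) hgU
  have hR : D.DefRel j (Set.range j) {x : Fin 3 → D.GStar j |
      x 0 ∈ S₀ ∧ x 1 ∈ S₁ ∧ x 2 ∈ S₂ ∧ x 0 * x 1 = x 2} :=
    (hS₀.defOver.mem 0).inter ((hS₁.defOver.mem 1).inter ((hS₂.defOver.mem 2).inter
      (DefRel.mul 0 1 2)))
  obtain ⟨y, h0, h1, h2, h3⟩ := hR.exists_incl_mem ⟨![g, h, g * h], hgS₀, hgS₁, hgS₂, rfl⟩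
  have e0 : f (y 0) ∈ V₁ := hFf (y 0) ▸ hSV₀ h0
  have e1 : f (y 1) ∈ V₂ := hFf (y 1) ▸ hSV₁ h1
  have e2 : F (D.incl j (y 0 * y 1)) ∈ U := by
    rw [map_mul]
    exact h3 ▸ hSV₂ h2
  rw [hFf, map_mul] at e2
  exact Set.disjoint_left.1 hUV e2 (hVV (Set.mk_mem_prod e0 e1))

/-- The kernel is the preimage of a closed point. A continuous map to a Hausdorff space cannot
separate elements of the same Δ-type, which bounds the index. -/
theorem ker_mem_boundedSubgroups (hC : IsMonster L C M κ) [T2Space K] {F : D.GStar j →* K}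
    (hF : @Continuous _ _ (D.deltaTopology j Ψ) _ F) : F.ker ∈ D.boundedSubgroups j Ψ κ := by
  let := D.deltaTopology j Ψ
  refine ⟨isClosed_deltaTopology_iff.1 (isClosed_singleton.preimage hF : IsClosed (F ⁻¹' {1})),
    mk_quotient_lt hC (Ψ := Ψ) fun a b hab => ?_⟩
  rw [MonoidHom.mem_ker, map_mul, map_inv, inv_mul_eq_one]
  by_contra hn
  obtain ⟨U, V, hU, hV, haU, hbV, hUV⟩ := t2_separation hn
  obtain ⟨S, hS, haS, hSU⟩ := isOpen_deltaTopology_iff.1 (hU.preimage hF) a haU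
  exact Set.disjoint_left.1 hUV (hSU ((hab S hS).1 haS)) hbV

theorem ext (hf : D.IsDeltaCompactification Ψ f) {K₁ : Type*} [Group K₁] [TopologicalSpace K₁]
    [T2Space K₁] {h h' : K →ₜ* K₁} (H : ∀ g, h (f g) = h' (f g)) : h = h' :=
  DFunLike.coe_injective (hf.denseRange.equalizer h.continuous_toFun h'.continuous_toFun
    (funext H))

theorem existsUnique_hom (hf : D.IsDeltaCompactification Ψ f) (hC : IsMonster L C M κ)
    [(D.component j Ψ κ).Normal] :
    ∃! h : (D.GStar j ⧸ D.component j Ψ κ) →ₜ* K,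
      ∀ g, h (D.natural j (D.component j Ψ κ) g) = f g := by
  have := hf.t2Space
  have hb := (isLeast_component (D := D) (j := j) (Ψ := Ψ) hC).1
  obtain ⟨F, hFf, hF⟩ := hf.exists_extension j
  have hker : D.component j Ψ κ ≤ F.ker :=
    (isLeast_component hC).2 (ker_mem_boundedSubgroups hC hF)
  refine ⟨⟨QuotientGroup.lift _ F hker, continuous_iff_isClosed.2 fun Z hZ => ?_⟩, hFf,
    fun h hh => (isDeltaCompactification_natural hC hb).ext fun g => (hh g).trans (hFf g).symm⟩
  refine isClosed_logicTopology_iff.2 (IsDeltaTypeDefinable.isTypeDefinable (Ψ := Ψ) ?_)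
  exact isClosed_deltaTopology_iff.1 (@IsClosed.preimage _ _ (D.deltaTopology j Ψ) _ _ hF _ hZ)

/-- Needed to test universality of some `f` against the quotient of `G*`, whose universe may differ
from the one quantified over. -/
theorem ulift (hf : D.IsDeltaCompactification Ψ f) :
    D.IsDeltaCompactification Ψ ((MulEquiv.ulift.{x, y} (α := K)).symm.toMonoidHom.comp f) where
  isTopologicalGroup :=
    have := hf.isTopologicalGroup
    inferInstance
  compactSpace :=
    have := hf.compactSpace
    inferInstance
  t2Space :=
    have := hf.t2Space
    inferInstance
  isDeltaDefinableMap := fun X Y hX hY hXY =>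
    hf.isDeltaDefinableMap (ULift.up ⁻¹' X) (ULift.up ⁻¹' Y) (hX.preimage continuous_uliftUp)
      (hY.preimage continuous_uliftUp) (hXY.preimage _)
  denseRange := ULift.up_surjective.denseRange.comp hf.denseRange continuous_uliftUp

end IsDeltaCompactification

end DefinableGroup

end DeltaBohr

/-! ### Universality and uniqueness of the Bohr compactification -/

theorem mainTheorem4
    {L : FirstOrder.Language.{u, v}} {M : Type w} [L.Structure M] {C : Type w'} [L.Structure C]
    (j : M ↪ₑ[L] C) (κ : Cardinal.{w'}) (hC : DeltaBohr.IsMonster L C M κ)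
    {n : ℕ} (D : DeltaBohr.DefinableGroup L M n)
    (Ψ : DeltaBohr.DefinableGroup.FormulaFamily L n) :
    IsLeast (D.boundedSubgroups j Ψ κ) (D.component j Ψ κ) ∧
    (∀ a b : D.GStar j, D.SameDeltaType j Ψ a b → a⁻¹ * b ∈ D.component j Ψ κ) ∧
    ∃ _ : (D.component j Ψ κ).Normal,
      DeltaBohr.DefinableGroup.IsUniversalDeltaCompactification.{u, v, w, w', y} D Ψ
        (D.natural j (D.component j Ψ κ)) ∧
      ∀ (K : Type y) [Group K] [TopologicalSpace K] (f : D.G →* K),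
        DeltaBohr.DefinableGroup.IsUniversalDeltaCompactification.{u, v, w, y, max w' y} D Ψ f →
        ∃! e : (D.GStar j ⧸ D.component j Ψ κ) ≃ₜ* K,
          ∀ g, e (D.natural j (D.component j Ψ κ) g) = f g := by
  have hl := DeltaBohr.DefinableGroup.isLeast_component (D := D) (j := j) (Ψ := Ψ) hC
  have hN := DeltaBohr.DefinableGroup.normal_component (D := D) (j := j) (Ψ := Ψ) hC
  have hπ := DeltaBohr.DefinableGroup.isDeltaCompactification_natural hC hl.1
  refine ⟨hl, fun a b hab => DeltaBohr.DefinableGroup.inv_mul_mem_of_sameDeltaType hC hl.1 hab,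
    hN, ⟨hπ, fun K₁ _ _ f₁ hf₁ => hf₁.existsUnique_hom hC⟩, fun K _ _ f hf => ?_⟩
  have := hπ.t2Space
  have := hf.1.t2Space
  obtain ⟨h, hh, -⟩ := hf.1.existsUnique_hom (j := j) hC
  obtain ⟨k, hk, -⟩ := hf.2 _ _ hπ.ulift.{_, _, _, _, y}
  have hkc : Continuous fun x => (k x).down := continuous_uliftDown.comp k.continuous_toFun
  -- The map in the other direction, brought down from the lifted universe; `h` and `k'` are
  -- mutually inverse because both composites fix a dense image of `G`.
  let k' : K →ₜ* (D.GStar j ⧸ D.component j Ψ κ) :=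
    ⟨(MulEquiv.ulift (α := D.GStar j ⧸ D.component j Ψ κ)).toMonoidHom.comp k.toMonoidHom, hkc⟩
  have hk' : ∀ g, k' (f g) = D.natural j (D.component j Ψ κ) g := fun g =>
    congrArg ULift.down (hk g)
  have h₁ : k'.comp h = ContinuousMonoidHom.id _ := hπ.ext fun g =>
    (congrArg k' (hh g)).trans (hk' g)
  have h₂ : h.comp k' = ContinuousMonoidHom.id _ := hf.1.ext fun g =>
    (congrArg h (hk' g)).trans (hh g)
  refine ⟨{ toFun := h, invFun := k', left_inv := DFunLike.congr_fun h₁,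
            right_inv := DFunLike.congr_fun h₂, map_mul' := map_mul h,
            continuous_toFun := h.continuous_toFun,
            continuous_invFun := k'.continuous_toFun }, hh, fun e he => ?_⟩
  refine DFunLike.coe_injective (hπ.denseRange.equalizer e.continuous_toFun h.continuous_toFun
    (funext fun g => (he g).trans (hh g).symm))
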